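/- **Proposition 3.6 (rough Laplacian formula).** Let $(M^m_p,g_M)$ and $(N^n_q,g_N)$ be smooth pseudo-Riemannian manifolds (without boundary) of dimensions $m,n$ and indices $p,q$, with Levi-Civita connections $\nabla$ and $\nabla^N$, and let $\varphi:M\to N$ be a $C^\infty$-map. Let $\overline\nabla$ be the connection on $\varphi^{-1}TN$ induced by $\nabla^N$, and let $\widetilde\nabla$ be the connections induced by $\nabla$ and $\overline\nabla$ on $\bigotimes^kT^*M\otimes\varphi^{-1}TN$. Thus, for vector fields $X,Y,Z,W$ on $M$, $$(\widetilde\nabla d\varphi)(X,Y)=\overline\nabla_X(d\varphi(Y))-d\varphi(\nabla_XY),$$ $$(\widetilde\nabla^2d\varphi)(X,Y,Z)=\overline\nabla_X\big((\widetilde\nabla d\varphi)(Y,Z)\big)-(\widetilde\nabla d\varphi)(\nabla_XY,Z)-(\widetilde\nabla d\varphi)(Y,\nabla_XZ),$$ $$(\widetilde\nabla^3d\varphi)(X,Y,Z,W)=\overline\nabla_X\big((\widetilde\nabla^2d\varphi)(Y,Z,W)\big)-(\widetilde\nabla^2d\varphi)(\nabla_XY,Z,W)-(\widetilde\nabla^2d\varphi)(Y,\nabla_XZ,W)-(\widetilde\nabla^2d\varphi)(Y,Z,\nabla_XW).$$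 Let $\tau(\varphi)=\mathrm{tr}_{g_M}(\widetilde\nabla d\varphi)$ be the tension field. For a section $V$ of $\varphi^{-1}TN$ let $-\overline\nabla^*\overline\nabla V=\mathrm{tr}_{g_M}\widetilde\nabla(\overline\nabla V)$ be its rough Laplacian, where $\overline\nabla^*\alpha=-\mathrm{tr}_{g_M}\widetilde\nabla\alpha$ is the formal adjoint of $\overline\nabla$, for one-forms $\alpha$ with values in $\varphi^{-1}TN$. Let $\{e_i\}_{i=1}^m$ be a smooth local pseudo-orthonormal frame field of $(M,g_M)$ on an open set $U\subseteq M$, that is, $g_M(e_i,e_j)=\varepsilon_i\delta_{ij}$ on $U$ with $\varepsilon_1=\dots=\varepsilon_p=-1$ and $\varepsilon_{p+1}=\dots=\varepsilon_m=1$. Then, at every point of $U$, $$-\overline\nabla^*\overline\nabla\tau(\varphi)=\sum_{i,j=1}^m\varepsilon_i\varepsilon_j(\widetilde\nabla^3d\varphi)(e_i,e_i,e_j,e_j).$$ Consequently, with $R^N(X,Y)=\nabla^N_X\nabla^N_Y-\nabla^N_Y\nabla^N_X-\nabla^N_{[X,Y]}$, Jiang's bitension field $$\tau_2(\varphi)=-\overline\nabla^*\overline\nabla\tau(\varphi)-\mathrm{tr}_{g_M}R^N\big(d\varphi(\cdot),\tau(\varphi)\big)d\varphi(\cdot)$$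 has, at every point of $U$, the alternative expression $$\tau_2(\varphi)=\sum_{i,j=1}^m\varepsilon_i\varepsilon_j\Big\{(\widetilde\nabla^3d\varphi)(e_i,e_i,e_j,e_j)+R^N\big((\widetilde\nabla d\varphi)(e_i,e_i),d\varphi(e_j)\big)d\varphi(e_j)\Big\}.$$ -/

import Mathlib

open Bundle Manifold ContDiff FiberBundle

set_option linter.unusedSectionVars false

/-! ### Pseudo-Riemannian metrics -/

section Metric

variable {E : Type*} [NormedAddCommGroup E] [NormedSpace ℝ E]
  {H : Type*} [TopologicalSpace H]

/-- A smooth pseudo-Riemannian metric of index `p` on a manifold `M`: a smooth field of symmetric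
nondegenerate bilinear forms on the tangent spaces, such that at every point the maximal dimension
of a negative definite subspace is `p`. -/
structure PseudoRiemannianMetric (I : ModelWithCorners ℝ E H) (M : Type*) [TopologicalSpace M]
    [ChartedSpace H M] [IsManifold I ∞ M] (p : ℕ) where
  /-- The scalar product on each tangent space. -/
  val (x : M) : TangentSpace I x →L[ℝ] TangentSpace I x →L[ℝ] ℝ
  symm (x : M) (u v : TangentSpace I x) : val x u v = val x v u
  nondegenerate (x : M) (u : TangentSpace I x) (hu : ∀ v, val x u v = 0) : u = 0
  contMDiff : ContMDiff I (I.prod 𝓘(ℝ, E →L[ℝ] E →L[ℝ] ℝ)) ∞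
    (fun x ↦ TotalSpace.mk' (E →L[ℝ] E →L[ℝ] ℝ) x (val x))
  index_eq (x : M) :
    sigNeg (LinearMap.BilinMap.toQuadraticMap (val x).toBilinForm) = p

end Metric

noncomputable section

/-! ### Levi-Civita connection, metric trace, curvature -/

section OneManifold

variable {E : Type*} [NormedAddCommGroup E] [NormedSpace ℝ E]
  {H : Type*} [TopologicalSpace H] {I : ModelWithCorners ℝ E H}
  {M : Type*} [TopologicalSpace M] [ChartedSpace H M] [IsManifold I ∞ M] {p : ℕ}

namespace PseudoRiemannianMetric

variable (g : PseudoRiemannianMetric I M p)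

/-- The function `y ↦ g_y(X_y, Y_y)`. -/
def pairing (X Y : Π y : M, TangentSpace I y) (y : M) : ℝ := g.val y (X y) (Y y)

lemma mdifferentiableAt_pairing {X Y : Π y : M, TangentSpace I y} {x : M}
    (hX : MDiffAt (T% X) x) (hY : MDiffAt (T% Y) x) :
    MDiffAt (g.pairing X Y) x := by
  have h1 : MDifferentiableAt I (I.prod 𝓘(ℝ)) (fun m ↦ TotalSpace.mk' ℝ (E := Bundle.Trivial M ℝ) m
      (g.val m (X m) (Y m))) x := by
    apply MDifferentiableAt.clm_bundle_apply₂ (F₁ := E) (F₂ := E)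
    · exact (g.contMDiff.contMDiffAt (x := x)).mdifferentiableAt (by simp)
    · exact hX
    · exact hY
  exact ((mdifferentiableAt_totalSpace (E := Bundle.Trivial M ℝ) I _).1 h1).2

lemma extend_add {x : M} (u v : TangentSpace I x) :
    ∀ᶠ y in nhds x, extend E (u + v) y = extend E u y + extend E v y := by
  have hx : x ∈ (trivializationAt E (TangentSpace I) x).baseSet := mem_baseSet_trivializationAt' x
  have h := ((trivializationAt E (TangentSpace I) x).linear ℝ hx).map_add u v
  filter_upwards [(trivializationAt E (TangentSpace I) x).open_baseSet.mem_nhds hx] with y hy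
  simp only [extend, h, ← Trivialization.symmₗ_apply (R := ℝ) _ hy, map_add]

lemma extend_smul {x : M} (a : ℝ) (u : TangentSpace I x) :
    ∀ᶠ y in nhds x, extend E (a • u) y = a • extend E u y := by
  have hx : x ∈ (trivializationAt E (TangentSpace I) x).baseSet := mem_baseSet_trivializationAt' x
  have h := ((trivializationAt E (TangentSpace I) x).linear ℝ hx).map_smul a u
  filter_upwards [(trivializationAt E (TangentSpace I) x).open_baseSet.mem_nhds hx] with y hy
  simp only [extend, h, ← Trivialization.symmₗ_apply (R := ℝ) _ hy, map_smul]

lemma _root_.mvfderiv_eq_of_eventuallyEq {F : Type*} [NormedAddCommGroup F] [NormedSpace ℝ F]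
    {f f' : M → F} {x : M} (h : f =ᶠ[nhds x] f') : d% f x = d% f' x := by
  ext v
  simp only [mvfderiv, h.mfderiv_eq]
  rfl

lemma pairing_comm (X Y : Π y : M, TangentSpace I y) : g.pairing X Y = g.pairing Y X :=
  funext fun y ↦ g.symm y _ _

lemma mdifferentiableAt_pairing_extend {x : M} (w z : TangentSpace I x) :
    MDiffAt (g.pairing (extend E w) (extend E z)) x :=
  g.mdifferentiableAt_pairing (mdifferentiableAt_extend I E w) (mdifferentiableAt_extend I E z)

lemma mvfderiv_pairing_extend_add {x : M} (w w' z : TangentSpace I x) :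
    d% (g.pairing (extend E (w + w')) (extend E z)) x =
      d% (g.pairing (extend E w) (extend E z)) x + d% (g.pairing (extend E w') (extend E z)) x := by
  rw [← mvfderiv_add (g.mdifferentiableAt_pairing_extend w z)
    (g.mdifferentiableAt_pairing_extend w' z)]
  apply mvfderiv_eq_of_eventuallyEq
  filter_upwards [extend_add w w'] with y hy
  simp [pairing, hy]

lemma mvfderiv_pairing_extend_smul {x : M} (a : ℝ) (w z : TangentSpace I x) :
    d% (g.pairing (extend E (a • w)) (extend E z)) x =
      a • d% (g.pairing (extend E w) (extend E z)) x := by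
  have e : g.pairing (extend E (a • w)) (extend E z) =ᶠ[nhds x]
      (fun _ : M ↦ a) • g.pairing (extend E w) (extend E z) := by
    filter_upwards [extend_smul a w] with y hy
    simp [pairing, hy]
  rw [mvfderiv_eq_of_eventuallyEq e, mvfderiv_smul mdifferentiableAt_const (g.mdifferentiableAt_pairing_extend w z)]
  ext u
  simp [mvfderiv_const]

/-- The bilinear map which sends `w, z ∈ T_xM` to the differential at `x` of the function `⟨W, Z⟩`,
where `W`, `Z` are the vector fields which extend `w`, `z` with constant coordinates in the
preferred chart at `x`. In coordinates, it is `∂_i g_{jk}`. -/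
def derivMetric (x : M) :
    TangentSpace I x →ₗ[ℝ] TangentSpace I x →ₗ[ℝ] (TangentSpace I x →L[ℝ] ℝ) :=
  LinearMap.mk₂ ℝ (fun w z ↦ d% (g.pairing (extend E w) (extend E z)) x)
    (fun w w' z ↦ g.mvfderiv_pairing_extend_add w w' z)
    (fun a w z ↦ g.mvfderiv_pairing_extend_smul a w z)
    (fun w z z' ↦ by
      simp only [g.pairing_comm (extend E w), g.mvfderiv_pairing_extend_add])
    (fun a w z ↦ by
      simp only [g.pairing_comm (extend E w), g.mvfderiv_pairing_extend_smul])

lemma derivMetric_apply (x : M) (w z : TangentSpace I x) :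
    g.derivMetric x w z = d% (g.pairing (extend E w) (extend E z)) x := rfl

lemma derivMetric_comm (x : M) (w z : TangentSpace I x) :
    g.derivMetric x w z = g.derivMetric x z w := by
  simp only [derivMetric_apply, g.pairing_comm (extend E w)]

/-- The coordinate representation, in the preferred chart at `x`, of a vector field `Y` near `x`. -/
def _root_.vectorFieldCoord (Y : Π y : M, TangentSpace I y) (x y : M) : E :=
  (trivializationAt E (TangentSpace I) x ⟨y, Y y⟩).2

lemma vectorFieldCoord_add (Y Z : Π y : M, TangentSpace I y) (x : M) :
    vectorFieldCoord (Y + Z) x =ᶠ[nhds x] vectorFieldCoord Y x + vectorFieldCoord Z x := by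
  have hx : x ∈ (trivializationAt E (TangentSpace I) x).baseSet := mem_baseSet_trivializationAt' x
  filter_upwards [(trivializationAt E (TangentSpace I) x).open_baseSet.mem_nhds hx] with y hy
  exact ((trivializationAt E (TangentSpace I) x).linear ℝ hy).map_add _ _

lemma vectorFieldCoord_smul (f : M → ℝ) (Y : Π y : M, TangentSpace I y) (x : M) :
    vectorFieldCoord (f • Y) x =ᶠ[nhds x] f • vectorFieldCoord Y x := by
  have hx : x ∈ (trivializationAt E (TangentSpace I) x).baseSet := mem_baseSet_trivializationAt' x
  filter_upwards [(trivializationAt E (TangentSpace I) x).open_baseSet.mem_nhds hx] with y hy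
  exact ((trivializationAt E (TangentSpace I) x).linear ℝ hy).map_smul _ _

variable [FiniteDimensional ℝ E]

instance (x : M) : FiniteDimensional ℝ (TangentSpace I x) := inferInstanceAs (FiniteDimensional ℝ E)

instance (x : M) : T2Space (TangentSpace I x) := inferInstanceAs (T2Space E)

lemma bilinForm_nondegenerate (x : M) : (g.val x).toBilinForm.Nondegenerate :=
  .ofSeparatingLeft fun u hu ↦ g.nondegenerate x u hu

/-- The metric trace `tr_g B = ∑ g^{ij} B(b_i, b_j)` of a bilinear map `B` on `T_xM`, computed as
`∑ B(b_i, b_i')` with a basis `b` of `T_xM` and its `g`-dual basis `b'`. -/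
def trace {A : Type*} [AddCommMonoid A] (x : M) (B : TangentSpace I x → TangentSpace I x → A) : A :=
  ∑ i, B (Module.finBasis ℝ (TangentSpace I x) i)
    ((g.val x).toBilinForm.dualBasis (g.bilinForm_nondegenerate x)
      (Module.finBasis ℝ (TangentSpace I x)) i)

/-- The right hand side `u⟨W, Z⟩ + w⟨U, Z⟩ - z⟨U, W⟩` of the Koszul formula, as a linear form in
`z`, for the vector fields `U, W, Z` which extend `u, w, z ∈ T_xM` with constant coordinates in the
preferred chart at `x` (the Lie brackets of these vector fields vanish near `x`). -/
def koszul (x : M) (u w : TangentSpace I x) : Module.Dual ℝ (TangentSpace I x) where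
  toFun z := g.derivMetric x w z u + g.derivMetric x u z w - g.derivMetric x u w z
  map_add' z z' := by
    simp only [map_add, add_apply]
    ring
  map_smul' a z := by
    simp only [map_smul, smul_apply, smul_eq_mul, RingHom.id_apply]
    ring

/-- The Christoffel symbols at `x`, in the preferred chart at `x`: `Γ(u, w) ∈ T_xM` is determined by
`2⟨Γ(u, w), z⟩ = u⟨W, Z⟩ + w⟨U, Z⟩ - z⟨U, W⟩`, that is,
`Γ^k_{ij} = ½ ∑_l g^{kl} (∂_i g_{jl} + ∂_j g_{il} - ∂_l g_{ij})`. -/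
def christoffel (x : M) :
    TangentSpace I x →ₗ[ℝ] TangentSpace I x →ₗ[ℝ] TangentSpace I x :=
  LinearMap.mk₂ ℝ
    (fun u w ↦ ((g.val x).toBilinForm.toDual (g.bilinForm_nondegenerate x)).symm
      ((1 / 2 : ℝ) • g.koszul x u w))
    (fun u u' w ↦ by
      rw [← map_add, ← smul_add]
      congr 2
      ext z
      simp only [koszul, map_add, add_apply, LinearMap.coe_mk, AddHom.coe_mk, LinearMap.add_apply]
      ring)
    (fun a u w ↦ by
      rw [← map_smul, smul_comm]
      congr 2
      ext z
      simp only [koszul, map_smul, smul_apply, LinearMap.coe_mk, AddHom.coe_mk,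
        LinearMap.smul_apply, smul_eq_mul]
      ring)
    (fun u w w' ↦ by
      rw [← map_add, ← smul_add]
      congr 2
      ext z
      simp only [koszul, map_add, add_apply, LinearMap.coe_mk, AddHom.coe_mk, LinearMap.add_apply]
      ring)
    (fun a u w ↦ by
      rw [← map_smul, smul_comm]
      congr 2
      ext z
      simp only [koszul, map_smul, smul_apply, LinearMap.coe_mk, AddHom.coe_mk,
        LinearMap.smul_apply, smul_eq_mul]
      ring)

lemma two_mul_val_christoffel (x : M) (u w z : TangentSpace I x) :
    2 * g.val x (g.christoffel x u w) z =
      g.derivMetric x w z u + g.derivMetric x u z w - g.derivMetric x u w z := by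
  have h : g.val x (g.christoffel x u w) z = (1 / 2 : ℝ) * g.koszul x u w z :=
    LinearMap.BilinForm.apply_toDual_symm_apply (hB := g.bilinForm_nondegenerate x)
      ((1 / 2 : ℝ) • g.koszul x u w) z
  rw [h]
  simp only [koszul, LinearMap.coe_mk, AddHom.coe_mk]
  ring

/-- The Levi-Civita connection of a pseudo-Riemannian metric. In the preferred chart at `x`, it is
`(∇_v Y)(x) = DY(v) + Γ(v, Y(x))`; as everywhere in Mathlib, `∇_v Y` at `x` is written
`leviCivita Y x v`. -/
def leviCivita : CovariantDerivative I E (TangentSpace I : M → Type _) where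
  toFun Y x :=
    ((trivializationAt E (TangentSpace I) x).symmL ℝ x).comp (d% (vectorFieldCoord Y x) x)
      + LinearMap.toContinuousLinearMap ((g.christoffel x).flip (Y x))
  isCovariantDerivativeOnUniv :=
    { add := by
        intro Y Z x hY hZ _
        have hY' : MDiffAt (vectorFieldCoord Y x) x := (mdifferentiableAt_section I Y).1 hY
        have hZ' : MDiffAt (vectorFieldCoord Z x) x := (mdifferentiableAt_section I Z).1 hZ
        have h : d% (vectorFieldCoord (Y + Z) x) x =
            d% (vectorFieldCoord Y x) x + d% (vectorFieldCoord Z x) x := by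
          rw [← mvfderiv_add hY' hZ', mvfderiv_eq_of_eventuallyEq (vectorFieldCoord_add Y Z x)]
        rw [h]
        ext v
        simp only [map_add, Pi.add_apply, add_apply, ContinuousLinearMap.comp_apply,
          LinearMap.coe_toContinuousLinearMap', LinearMap.flip_apply]
        abel
      leibniz := by
        intro Y f x hY hf _
        have hY' : MDiffAt (vectorFieldCoord Y x) x := (mdifferentiableAt_section I Y).1 hY
        have h : d% (vectorFieldCoord (f • Y) x) x = d% (f • vectorFieldCoord Y x) x :=
          mvfderiv_eq_of_eventuallyEq (vectorFieldCoord_smul f Y x)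
        have h' : (trivializationAt E (TangentSpace I) x).symmL ℝ x (vectorFieldCoord Y x x)
            = Y x := by
          have hx := mem_baseSet_trivializationAt' (F := E) (E := (TangentSpace I : M → Type _)) x
          rw [Trivialization.symmL_apply _ hx, vectorFieldCoord,
            Trivialization.symm_apply_apply_mk _ hx]
        rw [h, mvfderiv_smul hf hY']
        ext v
        simp [h']
        abel }

lemma vectorFieldCoord_extend {x : M} (w : TangentSpace I x) :
    vectorFieldCoord (extend E w) x =ᶠ[nhds x]
      fun _ ↦ (trivializationAt E (TangentSpace I) x ⟨x, w⟩).2 := by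
  have hx := mem_baseSet_trivializationAt' (F := E) (E := (TangentSpace I : M → Type _)) x
  filter_upwards [(trivializationAt E (TangentSpace I) x).open_baseSet.mem_nhds hx] with y hy
  simp [vectorFieldCoord, extend, Trivialization.apply_mk_symm _ hy]

lemma leviCivita_extend {x : M} (w v : TangentSpace I x) :
    g.leviCivita (extend E w) x v = g.christoffel x v w := by
  simp [leviCivita, mvfderiv_eq_of_eventuallyEq (vectorFieldCoord_extend w), mvfderiv_const]

/-- The Levi-Civita connection is compatible with the metric. -/
theorem leviCivita_metric {x : M} {Y Z : Π y : M, TangentSpace I y} (hY : MDiffAt (T% Y) x)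
    (hZ : MDiffAt (T% Z) x) (v : TangentSpace I x) :
    d% (g.pairing Y Z) x v = g.val x (g.leviCivita Y x v) (Z x) + g.val x (Y x) (g.leviCivita Z x v)
    := by
  have hc := g.leviCivita.isCovariantDerivativeOnUniv
  let Φ (Y Z : Π y : M, TangentSpace I y) : ℝ := d% (g.pairing Y Z) x v
    - g.val x (g.leviCivita Y x v) (Z x) - g.val x (Y x) (g.leviCivita Z x v)
  have hcomm (Y Z) : Φ Y Z = Φ Z Y := by
    simp only [Φ, g.pairing_comm Y Z, g.symm x _ (Z x), g.symm x (Y x)]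
    ring
  have h1 (Z : Π y : M, TangentSpace I y) (hZ : MDiffAt (T% Z) x) : TensorialAt I E (Φ · Z) x :=
    { smul := by
        intro f Y hf hY
        have e : g.pairing (f • Y) Z = f • g.pairing Y Z := by
          funext y
          simp [pairing]
        simp only [Φ, e, mvfderiv_smul hf (g.mdifferentiableAt_pairing hY hZ), hc.leibniz hY hf]
        simp [pairing]
        ring
      add := by
        intro Y Y' hY hY'
        have e : g.pairing (Y + Y') Z = g.pairing Y Z + g.pairing Y' Z := by
          funext y
          simp [pairing]
        simp only [Φ, e, mvfderiv_add (g.mdifferentiableAt_pairing hY hZ)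
          (g.mdifferentiableAt_pairing hY' hZ), hc.add hY hY']
        simp
        ring }
  have h2 (Y : Π y : M, TangentSpace I y) (hY : MDiffAt (T% Y) x) : TensorialAt I E (Φ Y ·) x := by
    simpa only [hcomm Y] using h1 Y hY
  have h3 : Φ Y Z = Φ (extend E (Y x)) (extend E (Z x)) :=
    TensorialAt.pointwise₂ h1 h2 hY (mdifferentiableAt_extend I E _) hZ
      (mdifferentiableAt_extend I E _) (by simp) (by simp)
  have h4 : Φ (extend E (Y x)) (extend E (Z x)) = 0 := by
    have a := g.two_mul_val_christoffel x v (Y x) (Z x)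
    have b := g.two_mul_val_christoffel x v (Z x) (Y x)
    simp only [Φ, ← derivMetric_apply, leviCivita_extend, extend_apply_self, g.symm x (Y x)]
    rw [g.derivMetric_comm x (Z x) (Y x)] at b
    linarith
  have h5 : Φ Y Z = 0 := h3.trans h4
  simp only [Φ] at h5
  linarith

lemma christoffel_comm (x : M) (u v : TangentSpace I x) :
    g.christoffel x u v = g.christoffel x v u := by
  have h : ∀ z, g.val x (g.christoffel x u v - g.christoffel x v u) z = 0 := by
    intro z
    have a := g.two_mul_val_christoffel x u v z
    have b := g.two_mul_val_christoffel x v u z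
    rw [g.derivMetric_comm x v u] at b
    simp only [map_sub, sub_apply]
    linarith
  exact sub_eq_zero.1 (g.nondegenerate x _ h)

lemma mlieBracket_extend {x : M} (u v : TangentSpace I x) :
    VectorField.mlieBracket I (extend E u) (extend E v) x = 0 := by
  have h (w : TangentSpace I x) :
      VectorField.mpullbackWithin 𝓘(ℝ, E) I (extChartAt I x).symm (extend E w) (Set.range I)
      =ᶠ[nhdsWithin (extChartAt I x x) (Set.range I)]
        fun _ ↦ (trivializationAt E (TangentSpace I) x ⟨x, w⟩).2 := by
    filter_upwards [extChartAt_target_mem_nhdsWithin x] with y hy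
    have hy' : (extChartAt I x).symm y ∈ (chartAt H x).source := by
      rw [← extChartAt_source I]
      exact (extChartAt I x).map_target hy
    have hb : (extChartAt I x).symm y ∈ (trivializationAt E (TangentSpace I) x).baseSet := hy'
    rw [VectorField.mpullbackWithin_apply, extend, ← Trivialization.symmL_apply (R := ℝ) _ hb,
      TangentBundle.symmL_trivializationAt hy', (extChartAt I x).right_inv hy]
    obtain ⟨e, he⟩ := isInvertible_mfderivWithin_extChartAt_symm (I := I) hy
    rw [← he, ContinuousLinearMap.inverse_equiv]
    exact e.symm_apply_apply _
  rw [← VectorField.mlieBracketWithin_univ, VectorField.mlieBracketWithin_apply]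
  have hm : extChartAt I x x ∈ (extChartAt I x).symm ⁻¹' Set.univ ∩ Set.range I := by simp
  rw [Filter.EventuallyEq.lieBracketWithin_vectorField_eq_of_mem
    ((h u).filter_mono (nhdsWithin_mono _ Set.inter_subset_right))
    ((h v).filter_mono (nhdsWithin_mono _ Set.inter_subset_right)) hm]
  simp only [VectorField.lieBracketWithin, fderivWithin_fun_const, Pi.zero_apply, zero_apply,
    sub_zero]
  exact map_zero _

/-- The Levi-Civita connection is torsion-free. -/
theorem leviCivita_torsion [CompleteSpace E] : g.leviCivita.torsion = 0 := by
  funext x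
  ext u v
  rw [CovariantDerivative.torsion_apply_eq_extend]
  simp only [extend_apply_self, leviCivita_extend]
  rw [mlieBracket_extend, g.christoffel_comm x u v]
  simp

end PseudoRiemannianMetric

/-- The curvature `R(X, Y)Z = ∇_X ∇_Y Z - ∇_Y ∇_X Z - ∇_{[X, Y]} Z` of an affine connection. -/
def curvatureField (D : CovariantDerivative I E (TangentSpace I : M → Type _))
    (X Y Z : Π y : M, TangentSpace I y) (x : M) : TangentSpace I x :=
  D (fun y ↦ D Z y (Y y)) x (X x) - D (fun y ↦ D Z y (X y)) x (Y x)
    - D Z x (VectorField.mlieBracket I X Y x)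

/-- The curvature tensor `R(u, v)w` at a point: the value of `R(U, V)W` for any vector fields
`U, V, W` which extend `u, v, w`. -/
def curvatureTensor (D : CovariantDerivative I E (TangentSpace I : M → Type _))
    (x : M) (u v w : TangentSpace I x) : TangentSpace I x :=
  curvatureField D (extend E u) (extend E v) (extend E w) x

end OneManifold

/-! ### Vector fields along a map -/

section AlongMap

variable {E : Type*} [NormedAddCommGroup E] [NormedSpace ℝ E] [FiniteDimensional ℝ E]
  {H : Type*} [TopologicalSpace H] {I : ModelWithCorners ℝ E H}
  {M : Type*} [TopologicalSpace M] [ChartedSpace H M] [IsManifold I ∞ M] {p : ℕ}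
  {E' : Type*} [NormedAddCommGroup E'] [NormedSpace ℝ E'] [FiniteDimensional ℝ E']
  {H' : Type*} [TopologicalSpace H'] {I' : ModelWithCorners ℝ E' H'}
  {N : Type*} [TopologicalSpace N] [ChartedSpace H' N] [IsManifold I' ∞ N] {q : ℕ}

/-- The connection induced on `φ⁻¹TN` by an affine connection `D` of `N`. Near `x`, write the
section `V` as `∑ V^a (∂_a ∘ φ)` with the coordinate fields `∂_a` of the preferred chart at `φ x`;
then `∇̄_v V = ∑ dV^a(v) ∂_a + V^a D_{dφ(v)} ∂_a` at `x`. The value `∇̄_v V` at `x` is written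
`pullbackConnection D φ V x v`. -/
def pullbackConnection (D : CovariantDerivative I' E' (TangentSpace I' : N → Type _)) (φ : M → N)
    (V : Π y : M, TangentSpace I' (φ y)) (x : M) : TangentSpace I x →L[ℝ] TangentSpace I' (φ x) :=
  ((trivializationAt E' (TangentSpace I') (φ x)).symmL ℝ (φ x)).comp
      (d% (fun y ↦ (trivializationAt E' (TangentSpace I') (φ x) ⟨φ y, V y⟩).2) x)
    + (D (extend E' (V x)) (φ x)).comp (mfderiv I I' φ x)

theorem pullbackConnection_add (D : CovariantDerivative I' E' (TangentSpace I' : N → Type _))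
    {φ : M → N} {x : M} {V W : Π y : M, TangentSpace I' (φ y)}
    (hV : MDifferentiableAt I I'.tangent (fun y ↦ (⟨φ y, V y⟩ : TangentBundle I' N)) x)
    (hW : MDifferentiableAt I I'.tangent (fun y ↦ (⟨φ y, W y⟩ : TangentBundle I' N)) x) :
    pullbackConnection (I := I) D φ (V + W) x =
      pullbackConnection D φ V x + pullbackConnection D φ W x := by
  have hx := mem_baseSet_trivializationAt' (F := E') (E := (TangentSpace I' : N → Type _)) (φ x)
  have hV' := (mdifferentiableAt_totalSpace I' _).1 hV
  have hW' := (mdifferentiableAt_totalSpace I' _).1 hW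
  have h : (fun y ↦ (trivializationAt E' (TangentSpace I') (φ x) ⟨φ y, (V + W) y⟩).2) =ᶠ[nhds x]
      (fun y ↦ (trivializationAt E' (TangentSpace I') (φ x) ⟨φ y, V y⟩).2) +
        (fun y ↦ (trivializationAt E' (TangentSpace I') (φ x) ⟨φ y, W y⟩).2) := by
    filter_upwards [hV'.1.continuousAt.preimage_mem_nhds
      ((trivializationAt E' (TangentSpace I') (φ x)).open_baseSet.mem_nhds hx)] with y hy
    exact ((trivializationAt E' (TangentSpace I') (φ x)).linear ℝ hy).map_add _ _
  have h2 : D (extend E' (V x + W x)) (φ x) = D (extend E' (V x)) (φ x) + D (extend E' (W x)) (φ x) := by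
    rw [← D.isCovariantDerivativeOnUniv.add (mdifferentiableAt_extend I' E' _)
      (mdifferentiableAt_extend I' E' _)]
    exact D.isCovariantDerivativeOnUniv.congr_of_eventuallyEq (mdifferentiableAt_extend I' E' _)
      (mdifferentiableAt_add_section (mdifferentiableAt_extend I' E' _)
        (mdifferentiableAt_extend I' E' _)) Filter.univ_mem
        (PseudoRiemannianMetric.extend_add (V x) (W x))
  rw [pullbackConnection, mvfderiv_eq_of_eventuallyEq h, mvfderiv_add hV'.2 hW'.2, Pi.add_apply, h2,
    pullbackConnection, pullbackConnection]
  ext v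
  simp only [add_apply, ContinuousLinearMap.comp_apply, map_add]
  abel

theorem pullbackConnection_leibniz (D : CovariantDerivative I' E' (TangentSpace I' : N → Type _))
    {φ : M → N} {x : M} {V : Π y : M, TangentSpace I' (φ y)} {f : M → ℝ}
    (hV : MDifferentiableAt I I'.tangent (fun y ↦ (⟨φ y, V y⟩ : TangentBundle I' N)) x)
    (hf : MDiffAt f x) :
    pullbackConnection (I := I) D φ (f • V) x =
      f x • pullbackConnection D φ V x + (d% f x).smulRight (V x) := by
  have hx := mem_baseSet_trivializationAt' (F := E') (E := (TangentSpace I' : N → Type _)) (φ x)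
  have hV' := (mdifferentiableAt_totalSpace I' _).1 hV
  have h : (fun y ↦ (trivializationAt E' (TangentSpace I') (φ x) ⟨φ y, (f • V) y⟩).2) =ᶠ[nhds x]
      f • (fun y ↦ (trivializationAt E' (TangentSpace I') (φ x) ⟨φ y, V y⟩).2) := by
    filter_upwards [hV'.1.continuousAt.preimage_mem_nhds
      ((trivializationAt E' (TangentSpace I') (φ x)).open_baseSet.mem_nhds hx)] with y hy
    exact ((trivializationAt E' (TangentSpace I') (φ x)).linear ℝ hy).map_smul _ _
  have h2 : D (extend E' (f x • V x)) (φ x) = f x • D (extend E' (V x)) (φ x) := by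
    rw [← D.isCovariantDerivativeOnUniv.smul_const (f x) (mdifferentiableAt_extend I' E' _)]
    exact D.isCovariantDerivativeOnUniv.congr_of_eventuallyEq (mdifferentiableAt_extend I' E' _)
      (mdifferentiableAt_const.smul_section (mdifferentiableAt_extend I' E' _)) Filter.univ_mem
        (PseudoRiemannianMetric.extend_smul (f x) (V x))
  have h3 : (trivializationAt E' (TangentSpace I') (φ x)).symmL ℝ (φ x)
      ((trivializationAt E' (TangentSpace I') (φ x) ⟨φ x, V x⟩).2) = V x := by
    rw [Trivialization.symmL_apply _ hx, Trivialization.symm_apply_apply_mk _ hx]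
  rw [pullbackConnection, mvfderiv_eq_of_eventuallyEq h, mvfderiv_smul hf hV'.2, Pi.smul_apply', h2,
    pullbackConnection]
  ext v
  simp [h3]
  abel

/-- With additivity and the Leibniz rule, the induced connection is characterized by
`∇̄_v (W ∘ φ) = D_{dφ(v)} W` for vector fields `W` on `N`. -/
theorem pullbackConnection_comp (D : CovariantDerivative I' E' (TangentSpace I' : N → Type _))
    {φ : M → N} {x : M} (hφ : MDifferentiableAt I I' φ x) {W : Π z : N, TangentSpace I' z}
    (hW : MDiffAt (T% W) (φ x)) :
    pullbackConnection (I := I) D φ (fun y ↦ W (φ y)) x = (D W (φ x)).comp (mfderiv I I' φ x) := by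
  have hx := mem_baseSet_trivializationAt' (F := E') (E := (TangentSpace I' : N → Type _)) (φ x)
  let Ψ (W : Π z : N, TangentSpace I' z) : TangentSpace I' (φ x) →L[ℝ] TangentSpace I' (φ x) :=
    D W (φ x) - ((trivializationAt E' (TangentSpace I') (φ x)).symmL ℝ (φ x)).comp
      (d% (vectorFieldCoord W (φ x)) (φ x))
  have hD := D.isCovariantDerivativeOnUniv
  have hΨ : TensorialAt I' E' Ψ (φ x) :=
    { smul := by
        intro f Y hf hY
        have hY' : MDiffAt (vectorFieldCoord Y (φ x)) (φ x) := (mdifferentiableAt_section I' Y).1 hY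
        have h3 : (trivializationAt E' (TangentSpace I') (φ x)).symmL ℝ (φ x)
            (vectorFieldCoord Y (φ x) (φ x)) = Y (φ x) := by
          rw [Trivialization.symmL_apply _ hx, vectorFieldCoord,
            Trivialization.symm_apply_apply_mk _ hx]
        simp only [Ψ]
        rw [hD.leibniz hY hf, mvfderiv_eq_of_eventuallyEq
          (PseudoRiemannianMetric.vectorFieldCoord_smul f Y (φ x)), mvfderiv_smul hf hY']
        ext v
        simp [h3, smul_sub]
      add := by
        intro Y Z hY hZ
        have hY' : MDiffAt (vectorFieldCoord Y (φ x)) (φ x) := (mdifferentiableAt_section I' Y).1 hY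
        have hZ' : MDiffAt (vectorFieldCoord Z (φ x)) (φ x) := (mdifferentiableAt_section I' Z).1 hZ
        simp only [Ψ]
        rw [hD.add hY hZ, mvfderiv_eq_of_eventuallyEq
          (PseudoRiemannianMetric.vectorFieldCoord_add Y Z (φ x)), mvfderiv_add hY' hZ']
        ext v
        simp only [sub_apply, add_apply, ContinuousLinearMap.comp_apply, map_add]
        abel }
  have h := hΨ.pointwise hW (mdifferentiableAt_extend I' E' (W (φ x))) (by simp)
  have h0 : d% (vectorFieldCoord (extend E' (W (φ x))) (φ x)) (φ x) = 0 := by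
    rw [mvfderiv_eq_of_eventuallyEq (PseudoRiemannianMetric.vectorFieldCoord_extend _),
      mvfderiv_const]
  have hW' : MDiffAt (vectorFieldCoord W (φ x)) (φ x) := (mdifferentiableAt_section I' W).1 hW
  have hc : d% (fun y ↦ (trivializationAt E' (TangentSpace I') (φ x) ⟨φ y, W (φ y)⟩).2) x =
      (d% (vectorFieldCoord W (φ x)) (φ x)).comp (mfderiv I I' φ x) := by
    have h1 := mfderiv_comp x hW' hφ
    ext v
    exact congr(NormedSpace.fromTangentSpace (vectorFieldCoord W (φ x) (φ x)) ($h1 v))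
  simp only [Ψ, h0, ContinuousLinearMap.comp_zero, sub_zero] at h
  rw [pullbackConnection, hc, ← h]
  ext v
  simp

/-- The connection `∇̃` induced on `T*M ⊗ φ⁻¹TN`: `(∇̃_X α)(Y) = ∇̄_X (α(Y)) - α(∇_X Y)`, for a
`φ⁻¹TN`-valued one-form `α` on `M`. -/
def oneFormDeriv (gM : PseudoRiemannianMetric I M p) (gN : PseudoRiemannianMetric I' N q) (φ : M → N)
    (α : Π y : M, TangentSpace I y →L[ℝ] TangentSpace I' (φ y)) (X Y : Π y : M, TangentSpace I y)
    (x : M) : TangentSpace I' (φ x) :=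
  pullbackConnection gN.leviCivita φ (fun y ↦ α y (Y y)) x (X x) - α x (gM.leviCivita Y x (X x))

/-- The second fundamental form `(∇̃dφ)(X, Y) = ∇̄_X (dφ(Y)) - dφ(∇_X Y)` of the map `φ`. -/
def secondFundamentalForm (gM : PseudoRiemannianMetric I M p) (gN : PseudoRiemannianMetric I' N q)
    (φ : M → N) (X Y : Π y : M, TangentSpace I y) : Π x : M, TangentSpace I' (φ x) :=
  oneFormDeriv gM gN φ (fun y ↦ mfderiv I I' φ y) X Y

/-- `(∇̃²dφ)(X, Y, Z) = ∇̄_X ((∇̃dφ)(Y, Z)) - (∇̃dφ)(∇_X Y, Z) - (∇̃dφ)(Y, ∇_X Z)`. -/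
def thirdFundamentalForm (gM : PseudoRiemannianMetric I M p) (gN : PseudoRiemannianMetric I' N q)
    (φ : M → N) (X Y Z : Π y : M, TangentSpace I y) (x : M) : TangentSpace I' (φ x) :=
  pullbackConnection gN.leviCivita φ (secondFundamentalForm gM gN φ Y Z) x (X x)
    - secondFundamentalForm gM gN φ (fun y ↦ gM.leviCivita Y y (X y)) Z x
    - secondFundamentalForm gM gN φ Y (fun y ↦ gM.leviCivita Z y (X y)) x

/-- `(∇̃³dφ)(X, Y, Z, W) = ∇̄_X ((∇̃²dφ)(Y, Z, W)) - (∇̃²dφ)(∇_X Y, Z, W) - (∇̃²dφ)(Y, ∇_X Z, W)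
- (∇̃²dφ)(Y, Z, ∇_X W)`. -/
def fourthFundamentalForm (gM : PseudoRiemannianMetric I M p) (gN : PseudoRiemannianMetric I' N q)
    (φ : M → N) (X Y Z W : Π y : M, TangentSpace I y) (x : M) : TangentSpace I' (φ x) :=
  pullbackConnection gN.leviCivita φ (thirdFundamentalForm gM gN φ Y Z W) x (X x)
    - thirdFundamentalForm gM gN φ (fun y ↦ gM.leviCivita Y y (X y)) Z W x
    - thirdFundamentalForm gM gN φ Y (fun y ↦ gM.leviCivita Z y (X y)) W x
    - thirdFundamentalForm gM gN φ Y Z (fun y ↦ gM.leviCivita W y (X y)) x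

/-- The metric trace `tr_g ∇̃α` of the covariant derivative of a `φ⁻¹TN`-valued one-form `α`; at
each point `x`, the tensor `∇̃α` is evaluated on tangent vectors `u, v` at `x` through vector fields
which extend them. -/
def oneFormDivergence (gM : PseudoRiemannianMetric I M p) (gN : PseudoRiemannianMetric I' N q)
    (φ : M → N) (α : Π y : M, TangentSpace I y →L[ℝ] TangentSpace I' (φ y)) (x : M) :
    TangentSpace I' (φ x) :=
  gM.trace x (fun u v ↦ oneFormDeriv gM gN φ α (extend E u) (extend E v) x)

/-- The tension field `τ(φ) = tr_g (∇̃dφ)`. -/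
def tensionField (gM : PseudoRiemannianMetric I M p) (gN : PseudoRiemannianMetric I' N q)
    (φ : M → N) : Π x : M, TangentSpace I' (φ x) :=
  oneFormDivergence gM gN φ (fun y ↦ mfderiv I I' φ y)

/-- The formal adjoint `∇̄*α = - tr_g (∇̃α)` of the connection `∇̄` of `φ⁻¹TN`, on `φ⁻¹TN`-valued
one-forms `α`. -/
def connectionAdjoint (gM : PseudoRiemannianMetric I M p) (gN : PseudoRiemannianMetric I' N q)
    (φ : M → N) (α : Π y : M, TangentSpace I y →L[ℝ] TangentSpace I' (φ y)) (x : M) :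
    TangentSpace I' (φ x) :=
  - oneFormDivergence gM gN φ α x

/-- The rough Laplacian `-∇̄*∇̄V` of a section `V` of `φ⁻¹TN`. For a local pseudo-orthonormal frame
`e_i` this is `∑ ε_i (∇̄_{e_i} ∇̄_{e_i} V - ∇̄_{∇_{e_i} e_i} V)`. -/
def roughLaplacian (gM : PseudoRiemannianMetric I M p) (gN : PseudoRiemannianMetric I' N q)
    (φ : M → N) (V : Π y : M, TangentSpace I' (φ y)) (x : M) : TangentSpace I' (φ x) :=
  - connectionAdjoint gM gN φ (pullbackConnection gN.leviCivita φ V) x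

/-- Jiang's bitension field `τ₂(φ) = -∇̄*∇̄τ(φ) - tr_g R^N(dφ(·), τ(φ)) dφ(·)`. -/
def bitensionField (gM : PseudoRiemannianMetric I M p) (gN : PseudoRiemannianMetric I' N q)
    (φ : M → N) (x : M) : TangentSpace I' (φ x) :=
  roughLaplacian gM gN φ (tensionField gM gN φ) x
    - gM.trace x (fun u v ↦ curvatureTensor gN.leviCivita (φ x) (mfderiv I I' φ x u)
        (tensionField gM gN φ x) (mfderiv I I' φ x v))

/-- The signs `ε_i = ⟨e_i, e_i⟩` of a pseudo-orthonormal basis in index `p`, with the `p` negative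
ones first. -/
def frameSign (p : ℕ) {m : ℕ} (i : Fin m) : ℝ := if (i : ℕ) < p then -1 else 1

/-- `e` is a smooth local pseudo-orthonormal frame field on the open set `U`. -/
structure IsPseudoOrthonormalFrame (gM : PseudoRiemannianMetric I M p) {m : ℕ}
    (e : Fin m → Π x : M, TangentSpace I x) (U : Set M) : Prop where
  isOpen : IsOpen U
  contMDiffOn (i : Fin m) : ContMDiffOn I I.tangent ∞ (fun x ↦ (⟨x, e i x⟩ : TangentBundle I M)) U
  val_eq (x : M) (hx : x ∈ U) (i j : Fin m) :
    gM.val x (e i x) (e j x) = if i = j then frameSign p i else 0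

end AlongMap
end

/-!
The frame formula for the rough Laplacian of the tension field rests on two facts about an operation
`T` which assigns to two smooth vector fields on `U` a section of `φ⁻¹TN` and which is tensorial,
with smooth components in the frame (`IsFrameTensor`). Let `∇_X T` be the operation
`(Y, Z) ↦ ∇̄_X (T(Y, Z)) - T(∇_X Y, Z) - T(Y, ∇_X Z)` (`tensorDeriv`).

* `∇_X T` is again tensorial with smooth components (`IsFrameTensor.tensorDeriv`): in the frame, the
  derivatives of the components of `Y` and `Z` cancel.
* The metric trace commutes with `∇_X`, that is, `∑ ε_j (∇_X T)(e_j, e_j) = ∇̄_X (∑ ε_j T(e_j, e_j))`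
  (`IsFrameTensor.sum_tensorDeriv`): the remaining terms vanish since the connection matrix
  `⟨∇_X e_j, e_k⟩` is antisymmetric.

With `T = ∇̃dφ` this gives `∑ ε_j (∇̃²dφ)(X, e_j, e_j) = ∇̄_X τ`, and then with `T = (∇̃²dφ)(Y, ·, ·)` it
gives `∑ ε_j (∇̃³dφ)(X, Y, e_j, e_j) = ∇̄_X ∇̄_Y τ - ∇̄_{∇_X Y} τ`. Putting `X = Y = e_i` and tracing
with `oneFormDivergence_eq` yields the rough Laplacian. For the bitension field, the curvature
term is expanded in the frame with the bilinearity of `(u, w) ↦ R(u, v)w` and the antisymmetry of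
`R` in its first two arguments.

Since the connections are defined pointwise, in a chart which depends on the point, their smoothness
has to be established. For the Levi-Civita connection it follows from the Koszul formula and the
inverse Gram matrix of a coordinate frame (`PseudoRiemannianMetric.contMDiffOn_leviCivita`); for the
induced connection, from the expansion of a section in a coordinate frame of `N` along `φ`
(`isSmoothAlong_pullbackConnection`).
-/

noncomputable section

/-! ### Smoothness of the Levi-Civita connection -/

section SmoothFunctions

variable {E : Type*} [NormedAddCommGroup E] [NormedSpace ℝ E]
  {H : Type*} [TopologicalSpace H] {I : ModelWithCorners ℝ E H}
  {M : Type*} [TopologicalSpace M] [ChartedSpace H M] {U : Set M}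

lemma ContMDiffOn.matrix_det {ι : Type*} [Fintype ι] [DecidableEq ι] {G : M → Matrix ι ι ℝ}
    (hG : ∀ a b, CMDiff[U] ∞ (fun y ↦ G y a b)) : CMDiff[U] ∞ (fun y ↦ (G y).det) := by
  simp only [Matrix.det_apply, Units.smul_def, zsmul_eq_mul]
  exact contMDiffOn_finsetSum fun σ _ ↦ contMDiffOn_const.mul
    (contMDiffOn_finsetProd fun i _ ↦ hG (σ i) i)

lemma ContMDiffOn.matrix_inv {ι : Type*} [Fintype ι] [DecidableEq ι] {G : M → Matrix ι ι ℝ}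
    (hG : ∀ a b, CMDiff[U] ∞ (fun y ↦ G y a b)) (hdet : ∀ y ∈ U, (G y).det ≠ 0) (a b : ι) :
    CMDiff[U] ∞ (fun y ↦ (G y)⁻¹ a b) := by
  simp only [Matrix.inv_def, Ring.inverse_eq_inv', Matrix.smul_apply, smul_eq_mul,
    Matrix.adjugate_apply]
  refine ((ContMDiffOn.matrix_det hG).inv₀ hdet).mul (ContMDiffOn.matrix_det fun c d ↦ ?_)
  by_cases h : c = b
  · subst h
    simpa using contMDiffOn_const
  · simpa [Matrix.updateRow_ne h] using hG c d

variable [IsManifold I ∞ M]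

lemma ContMDiffOn.mvfderiv_apply {F : Type*} [NormedAddCommGroup F] [NormedSpace ℝ F]
    {f : M → F} {X : Π y : M, TangentSpace I y} (hU : IsOpen U) (hf : CMDiff[U] ∞ f)
    (hX : CMDiff[U] ∞ (T% X)) : CMDiff[U] ∞ (fun y ↦ d% f y (X y)) := by
  have h := (hf.contMDiffOn_tangentMapWithin (m := ∞) (by simp) hU.uniqueMDiffOn).comp hX
    (fun y hy ↦ hy)
  intro y hy
  refine ((contMDiffWithinAt_totalSpace).1 (h y hy)).2.congr (fun z hz ↦ ?_) ?_
  · simp [tangentMapWithin, mvfderiv, mfderivWithin_of_isOpen hU hz]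
    rfl
  · simp [tangentMapWithin, mvfderiv, mfderivWithin_of_isOpen hU hy]
    rfl

end SmoothFunctions

section LeviCivita

variable {E : Type*} [NormedAddCommGroup E] [NormedSpace ℝ E] [FiniteDimensional ℝ E]
  {H : Type*} [TopologicalSpace H] {I : ModelWithCorners ℝ E H}
  {M : Type*} [TopologicalSpace M] [ChartedSpace H M] [IsManifold I ∞ M] {p : ℕ} {U : Set M}

lemma contMDiffOn_mlieBracket (hU : IsOpen U) {X Y : Π y : M, TangentSpace I y}
    (hX : CMDiff[U] ∞ (T% X)) (hY : CMDiff[U] ∞ (T% Y)) :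
    CMDiff[U] ∞ (T% (VectorField.mlieBracket I X Y)) := by
  have : IsManifold I (minSmoothness ℝ 2) M :=
    by
    rw [minSmoothness_of_isRCLikeNormedField]; infer_instance
  have : IsManifold I (((⊤ : ℕ∞) : WithTop ℕ∞) + 1) M := ‹IsManifold I ∞ M›
  exact fun y hy ↦ (ContMDiffAt.mlieBracket_vectorField (m := ⊤) (n := ⊤)
    (hX.contMDiffAt (hU.mem_nhds hy)) (hY.contMDiffAt (hU.mem_nhds hy))
    (by simp)).contMDiffWithinAt

namespace PseudoRiemannianMetric

variable (g : PseudoRiemannianMetric I M p)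

lemma contMDiffOn_pairing {X Y : Π y : M, TangentSpace I y}
    (hX : CMDiff[U] ∞ (T% X)) (hY : CMDiff[U] ∞ (T% Y)) : CMDiff[U] ∞ (g.pairing X Y) := by
  have h1 : ContMDiffOn I (I.prod 𝓘(ℝ)) ∞ (fun m ↦ TotalSpace.mk' ℝ (E := Bundle.Trivial M ℝ) m
      (g.val m (X m) (Y m))) U :=
    ContMDiffOn.clm_bundle_apply₂ (F₁ := E) (F₂ := E) g.contMDiff.contMDiffOn hX hY
  exact fun y hy ↦ ((contMDiffWithinAt_totalSpace).1 (h1 y hy)).2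

/-- A vector field is smooth as soon as its pairings with smooth vector fields are: its
components in a coordinate frame are obtained from such pairings by the inverse Gram matrix. -/
lemma contMDiffOn_of_pairing (hU : IsOpen U) {W : Π y : M, TangentSpace I y}
    (h : ∀ V ⊆ U, IsOpen V → ∀ Z : Π y : M, TangentSpace I y, CMDiff[V] ∞ (T% Z) →
      CMDiff[V] ∞ (g.pairing W Z)) : CMDiff[U] ∞ (T% W) := by
  intro x hx
  set t := trivializationAt E (TangentSpace I) x
  let b := Module.finBasis ℝ E
  have hxt : x ∈ t.baseSet := mem_baseSet_trivializationAt' x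
  let V := U ∩ t.baseSet
  have hV : IsOpen V := hU.inter t.open_baseSet
  have hE (a) : CMDiff[V] ∞ (T% (t.localFrame b a)) :=
    (t.contMDiffOn_localFrame_baseSet ∞ b a).mono Set.inter_subset_right
  let G (y : M) : Matrix _ _ ℝ := .of fun a c ↦ g.pairing (t.localFrame b c) (t.localFrame b a) y
  have hG (a c) : CMDiff[V] ∞ (fun y ↦ G y a c) := g.contMDiffOn_pairing (hE c) (hE a)
  have hdet : ∀ y ∈ V, (G y).det ≠ 0 := by
    intro y hy
    have := (LinearMap.BilinForm.nondegenerate_iff_det_ne_zero (t.basisAt b hy.2)).1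
      (g.bilinForm_nondegenerate y)
    suffices h : G y = LinearMap.BilinForm.toMatrix (t.basisAt b hy.2) (g.val y).toBilinForm by
      rwa [h]
    ext a c
    simp only [G, pairing, Matrix.of_apply, t.localFrame_apply_of_mem_baseSet b hy.2]
    rw [g.symm]
    simp [LinearMap.BilinForm.toMatrix_apply]
  refine ((contMDiffAt_iff_localFrameCoeff b hxt).2 fun a ↦ ?_).contMDiffWithinAt
  have hs : CMDiff[V] ∞ (fun y ↦ ∑ c, (G y)⁻¹ a c * g.pairing W (t.localFrame b c) y) :=
    contMDiffOn_finsetSum fun c _ ↦ (ContMDiffOn.matrix_inv hG hdet a c).mul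
      (h V Set.inter_subset_left hV _ (hE c))
  refine (hs.contMDiffAt (hV.mem_nhds ⟨hx, hxt⟩)).congr_of_eventuallyEq ?_
  filter_upwards [hV.mem_nhds ⟨hx, hxt⟩] with y hy
  let c := fun a ↦ t.localFrameCoeff I b a y (W y)
  have hW : W y = ∑ a, c a • t.localFrame b a y := t.eq_sum_localFrameCoeff_smul hy.2
  have hr : (fun a ↦ g.pairing W (t.localFrame b a) y) = (G y).mulVec c := by
    funext a
    simp only [pairing, Matrix.mulVec, dotProduct, G, Matrix.of_apply]
    rw [hW]
    simp [mul_comm]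
  have : c = (G y)⁻¹.mulVec (fun a ↦ g.pairing W (t.localFrame b a) y) := by
    rw [hr, Matrix.mulVec_mulVec, Matrix.nonsing_inv_mul _ (hdet y hy).isUnit, Matrix.one_mulVec]
  exact congrFun this a

/-- The value of the Levi-Civita connection depends only on the germ of the vector field; no
differentiability is required. -/
lemma leviCivita_congr {x : M} {Y Y' : Π y : M, TangentSpace I y} (h : ∀ᶠ y in nhds x, Y y = Y' y) :
    g.leviCivita Y x = g.leviCivita Y' x := by
  have h1 : vectorFieldCoord Y x =ᶠ[nhds x] vectorFieldCoord Y' x := by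
    filter_upwards [h] with y hy
    simp [vectorFieldCoord, hy]
  change ((trivializationAt E (TangentSpace I) x).symmL ℝ x).comp (d% (vectorFieldCoord Y x) x)
      + LinearMap.toContinuousLinearMap ((g.christoffel x).flip (Y x)) =
    ((trivializationAt E (TangentSpace I) x).symmL ℝ x).comp (d% (vectorFieldCoord Y' x) x)
      + LinearMap.toContinuousLinearMap ((g.christoffel x).flip (Y' x))
  rw [mvfderiv_eq_of_eventuallyEq h1, h.self_of_nhds]

lemma leviCivita_sub_swap {x : M} {X Y : Π y : M, TangentSpace I y} (hX : MDiffAt (T% X) x)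
    (hY : MDiffAt (T% Y) x) : g.leviCivita Y x (X x) = g.leviCivita X x (Y x) +
      VectorField.mlieBracket I X Y x := by
  have : CompleteSpace E := FiniteDimensional.complete ℝ E
  have h := CovariantDerivative.torsion_apply (cov := g.leviCivita) hX hY
  rw [g.leviCivita_torsion] at h
  have h' : (0 : TangentSpace I x) = g.leviCivita Y x (X x) - g.leviCivita X x (Y x) -
    VectorField.mlieBracket I X Y x := h
  rw [eq_comm, sub_sub, sub_eq_zero] at h'
  exact h'

/-- The Koszul formula. -/
lemma two_mul_val_leviCivita {x : M} {X Y Z : Π y : M, TangentSpace I y} (hX : MDiffAt (T% X) x)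
    (hY : MDiffAt (T% Y) x) (hZ : MDiffAt (T% Z) x) :
    2 * g.val x (g.leviCivita Y x (X x)) (Z x) =
      d% (g.pairing Y Z) x (X x) + d% (g.pairing X Z) x (Y x) - d% (g.pairing X Y) x (Z x)
      + g.pairing (VectorField.mlieBracket I X Y) Z x
      - g.pairing (VectorField.mlieBracket I X Z) Y x
      - g.pairing (VectorField.mlieBracket I Y Z) X x := by
  rw [g.leviCivita_metric hY hZ, g.leviCivita_metric hX hZ, g.leviCivita_metric hX hY]
  have h1 := g.leviCivita_sub_swap hX hY
  have h2 := g.leviCivita_sub_swap hX hZ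
  have h3 := g.leviCivita_sub_swap hY hZ
  rw [h2, h3, h1, pairing, pairing, pairing, g.symm x (X x) (g.leviCivita Y x (Z x)),
    g.symm x (X x) (g.leviCivita Y x (Z x) + _), g.symm x (Y x)]
  simp only [map_add, add_apply]
  ring

/-- The Levi-Civita connection maps smooth vector fields to smooth vector fields. -/
theorem contMDiffOn_leviCivita (hU : IsOpen U) {X Y : Π y : M, TangentSpace I y}
    (hX : CMDiff[U] ∞ (T% X)) (hY : CMDiff[U] ∞ (T% Y)) :
    CMDiff[U] ∞ (T% (fun y ↦ g.leviCivita Y y (X y))) := by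
  refine g.contMDiffOn_of_pairing hU fun V hVU hV Z hZ ↦ ?_
  replace hX := hX.mono hVU
  replace hY := hY.mono hVU
  have hs := contMDiffOn_const (c := (1 / 2 : ℝ)).mul
    (((((((g.contMDiffOn_pairing hY hZ).mvfderiv_apply hV hX).add
    ((g.contMDiffOn_pairing hX hZ).mvfderiv_apply hV hY)).sub
    ((g.contMDiffOn_pairing hX hY).mvfderiv_apply hV hZ)).add
    (g.contMDiffOn_pairing (contMDiffOn_mlieBracket hV hX hY) hZ)).sub
    (g.contMDiffOn_pairing (contMDiffOn_mlieBracket hV hX hZ) hY)).sub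
    (g.contMDiffOn_pairing (contMDiffOn_mlieBracket hV hY hZ) hX))
  refine hs.congr fun y hy ↦ ?_
  have hd {Z : Π y : M, TangentSpace I y} (hZ : CMDiff[V] ∞ (T% Z)) : MDiffAt (T% Z) y :=
    (hZ.contMDiffAt (hV.mem_nhds hy)).mdifferentiableAt (by simp)
  have := g.two_mul_val_leviCivita (hd hX) (hd hY) (hd hZ)
  simp only [Pi.mul_apply, Pi.add_apply, pairing] at this ⊢
  linarith

end PseudoRiemannianMetric

end LeviCivita

/-! ### Smooth vector fields along a map -/

section AlongMap

variable {E : Type*} [NormedAddCommGroup E] [NormedSpace ℝ E] [FiniteDimensional ℝ E]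
  {H : Type*} [TopologicalSpace H] {I : ModelWithCorners ℝ E H}
  {M : Type*} [TopologicalSpace M] [ChartedSpace H M] [IsManifold I ∞ M] {p : ℕ}
  {E' : Type*} [NormedAddCommGroup E'] [NormedSpace ℝ E'] [FiniteDimensional ℝ E']
  {H' : Type*} [TopologicalSpace H'] {I' : ModelWithCorners ℝ E' H'}
  {N : Type*} [TopologicalSpace N] [ChartedSpace H' N] [IsManifold I' ∞ N] {q : ℕ}

variable (I) in
/-- The section `V` of `φ⁻¹TN` is smooth on `U`, as a map from `M` to `TN`. -/
def IsSmoothAlong (φ : M → N) (V : Π y : M, TangentSpace I' (φ y)) (U : Set M) : Prop :=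
  ContMDiffOn I I'.tangent ∞ (fun y ↦ (⟨φ y, V y⟩ : TangentBundle I' N)) U

variable {φ : M → N} {U : Set M}

lemma isSmoothAlong_iff (hφ : ContMDiff I I' ∞ φ) {V : Π y : M, TangentSpace I' (φ y)} :
    IsSmoothAlong I φ V U ↔ ∀ x ∈ U, ContMDiffWithinAt I 𝓘(ℝ, E') ∞
      (fun y ↦ (trivializationAt E' (TangentSpace I') (φ x) ⟨φ y, V y⟩).2) U x := by
  refine forall₂_congr fun x _ ↦ ?_
  rw [contMDiffWithinAt_totalSpace]
  exact and_iff_right hφ.contMDiffAt.contMDiffWithinAt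

namespace IsSmoothAlong

variable {V W : Π y : M, TangentSpace I' (φ y)}

lemma mdifferentiableAt (hV : IsSmoothAlong I φ V U) (hU : IsOpen U) {x : M} (hx : x ∈ U) :
    MDifferentiableAt I I'.tangent (fun y ↦ (⟨φ y, V y⟩ : TangentBundle I' N)) x :=
  (ContMDiffOn.contMDiffAt hV (hU.mem_nhds hx)).mdifferentiableAt (by simp)

lemma mono (hV : IsSmoothAlong I φ V U) {U' : Set M} (h : U' ⊆ U) : IsSmoothAlong I φ V U' :=
  ContMDiffOn.mono hV h

lemma congr (hV : IsSmoothAlong I φ V U) (h : ∀ y ∈ U, W y = V y) : IsSmoothAlong I φ W U :=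
  ContMDiffOn.congr hV fun y hy ↦ by rw [h y hy]

lemma eventually_mem_baseSet (hφ : ContMDiff I I' ∞ φ) (x : M) :
    ∀ᶠ y in nhds x, φ y ∈ (trivializationAt E' (TangentSpace I') (φ x)).baseSet :=
  hφ.continuous.continuousAt.preimage_mem_nhds
    ((trivializationAt E' (TangentSpace I') (φ x)).open_baseSet.mem_nhds
      (mem_baseSet_trivializationAt' (φ x)))

lemma add (hφ : ContMDiff I I' ∞ φ) (hV : IsSmoothAlong I φ V U) (hW : IsSmoothAlong I φ W U) :
    IsSmoothAlong I φ (V + W) U := by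
  refine (isSmoothAlong_iff hφ).2 fun x hx ↦ ?_
  refine (((isSmoothAlong_iff hφ).1 hV x hx).add ((isSmoothAlong_iff hφ).1 hW x
    hx)).congr_of_eventuallyEq_of_mem (Filter.Eventually.filter_mono nhdsWithin_le_nhds ?_) hx
  filter_upwards [eventually_mem_baseSet hφ x] with y hy
  exact ((trivializationAt E' (TangentSpace I') (φ x)).linear ℝ hy).map_add _ _

lemma smul (hφ : ContMDiff I I' ∞ φ) {f : M → ℝ} (hf : CMDiff[U] ∞ f)
    (hV : IsSmoothAlong I φ V U) : IsSmoothAlong I φ (f • V) U := by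
  refine (isSmoothAlong_iff hφ).2 fun x hx ↦ ?_
  refine ((hf x hx).smul ((isSmoothAlong_iff hφ).1 hV x hx)).congr_of_eventuallyEq_of_mem
    (Filter.Eventually.filter_mono nhdsWithin_le_nhds ?_) hx
  filter_upwards [eventually_mem_baseSet hφ x] with y hy
  exact ((trivializationAt E' (TangentSpace I') (φ x)).linear ℝ hy).map_smul _ _

lemma sub (hφ : ContMDiff I I' ∞ φ) (hV : IsSmoothAlong I φ V U) (hW : IsSmoothAlong I φ W U) :
    IsSmoothAlong I φ (fun y ↦ V y - W y) U :=
  (hV.add hφ (hW.smul hφ (contMDiffOn_const (c := (-1 : ℝ))))).congr fun y _ ↦ by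
    simp [sub_eq_add_neg]

lemma zero (hφ : ContMDiff I I' ∞ φ) :
    IsSmoothAlong I φ (0 : Π y : M, TangentSpace I' (φ y)) U := by
  refine (isSmoothAlong_iff hφ).2 fun x hx ↦ ?_
  refine (contMDiffWithinAt_const (c := (0 : E'))).congr_of_eventuallyEq_of_mem
    (Filter.Eventually.filter_mono nhdsWithin_le_nhds ?_) hx
  filter_upwards [eventually_mem_baseSet hφ x] with y hy
  exact ((trivializationAt E' (TangentSpace I') (φ x)).linear ℝ hy).map_zero

lemma sum (hφ : ContMDiff I I' ∞ φ) {ι : Type*} (s : Finset ι)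
    {V : ι → Π y : M, TangentSpace I' (φ y)} (hV : ∀ i, IsSmoothAlong I φ (V i) U) :
    IsSmoothAlong I φ (∑ i ∈ s, V i) U := by
  classical
  induction s using Finset.induction_on with
  | empty => simpa using zero hφ
  | insert i s hi ih =>
    rw [Finset.sum_insert hi]
    exact (hV i).add hφ ih

lemma sum_smul (hφ : ContMDiff I I' ∞ φ) {ι : Type*} [Fintype ι] {f : ι → M → ℝ}
    {V : ι → Π y : M, TangentSpace I' (φ y)} (hf : ∀ i, CMDiff[U] ∞ (f i))
    (hV : ∀ i, IsSmoothAlong I φ (V i) U) :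
    IsSmoothAlong I φ (fun y ↦ ∑ i, f i y • V i y) U :=
  (sum hφ Finset.univ fun i ↦ (hV i).smul hφ (hf i)).congr fun y _ ↦ by simp

lemma mfderiv_apply (hφ : ContMDiff I I' ∞ φ) {X : Π y : M, TangentSpace I y}
    (hX : CMDiff[U] ∞ (T% X)) : IsSmoothAlong I φ (fun y ↦ mfderiv I I' φ y (X y)) U :=
  (hφ.contMDiff_tangentMap (m := ∞) (by simp)).comp_contMDiffOn hX

lemma comp (hφ : ContMDiff I I' ∞ φ) {W : Π z : N, TangentSpace I' z} {O : Set N}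
    (hW : CMDiff[O] ∞ (T% W)) (h : ∀ y ∈ U, φ y ∈ O) : IsSmoothAlong I φ (fun y ↦ W (φ y)) U :=
  ContMDiffOn.comp hW hφ.contMDiffOn h

end IsSmoothAlong

/-! ### The induced connection on smooth sections -/

section PullbackConnection

variable {D : CovariantDerivative I' E' (TangentSpace I' : N → Type _)}

/-- The value of the induced connection depends only on the germ of the section. -/
lemma pullbackConnection_congr {V W : Π y : M, TangentSpace I' (φ y)} {x : M}
    (h : ∀ᶠ y in nhds x, V y = W y) :
    pullbackConnection (I := I) D φ V x = pullbackConnection D φ W x := by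
  have h1 : (fun y ↦ (trivializationAt E' (TangentSpace I') (φ x) ⟨φ y, V y⟩).2) =ᶠ[nhds x]
      (fun y ↦ (trivializationAt E' (TangentSpace I') (φ x) ⟨φ y, W y⟩).2) := by
    filter_upwards [h] with y hy
    rw [hy]
  rw [pullbackConnection, pullbackConnection, mvfderiv_eq_of_eventuallyEq h1, h.self_of_nhds]

lemma pullbackConnection_sum_smul (hφ : ContMDiff I I' ∞ φ) (hU : IsOpen U) {ι : Type*}
    (s : Finset ι) {f : ι → M → ℝ} {V : ι → Π y : M, TangentSpace I' (φ y)}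
    (hf : ∀ i, CMDiff[U] ∞ (f i)) (hV : ∀ i, IsSmoothAlong I φ (V i) U) {x : M} (hx : x ∈ U)
    (v : TangentSpace I x) :
    pullbackConnection (I := I) D φ (fun y ↦ ∑ i ∈ s, f i y • V i y) x v =
      ∑ i ∈ s, (f i x • pullbackConnection D φ (V i) x v + d% (f i) x v • V i x) := by
  classical
  have hd (i) : MDiffAt (f i) x := ((hf i).contMDiffAt (hU.mem_nhds hx)).mdifferentiableAt (by simp)
  induction s using Finset.induction_on with
  | empty =>
    have h0 : (fun y ↦ ∑ i ∈ (∅ : Finset ι), f i y • V i y) =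
        (fun _ : M ↦ (0 : ℝ)) • (0 : Π y : M, TangentSpace I' (φ y)) := by
      funext y
      simp
    rw [h0, pullbackConnection_leibniz D ((IsSmoothAlong.zero hφ).mdifferentiableAt hU hx)
      mdifferentiableAt_const]
    simp
  | insert i s hi ih =>
    have h1 : (fun y ↦ ∑ j ∈ insert i s, f j y • V j y) =
        f i • V i + ∑ j ∈ s, f j • V j := by
      funext y
      simp [Finset.sum_insert hi]
    have h2 : (fun y ↦ ∑ j ∈ s, f j y • V j y) = ∑ j ∈ s, f j • V j := by
      funext y
      simp
    rw [h1, pullbackConnection_add D (((hV i).smul hφ (hf i)).mdifferentiableAt hU hx)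
      ((IsSmoothAlong.sum hφ s fun j ↦ (hV j).smul hφ (hf j)).mdifferentiableAt hU hx),
      pullbackConnection_leibniz D ((hV i).mdifferentiableAt hU hx) (hd i), add_apply, ← h2, ih,
      Finset.sum_insert hi]
    simp

/-- The connection induced by a Levi-Civita connection maps smooth sections to smooth sections. -/
theorem isSmoothAlong_pullbackConnection (gN : PseudoRiemannianMetric I' N q)
    (hφ : ContMDiff I I' ∞ φ) (hU : IsOpen U) {V : Π y : M, TangentSpace I' (φ y)}
    (hV : IsSmoothAlong I φ V U) {X : Π y : M, TangentSpace I y} (hX : CMDiff[U] ∞ (T% X)) :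
    IsSmoothAlong I φ (fun y ↦ pullbackConnection gN.leviCivita φ V y (X y)) U := by
  intro x hx
  set t := trivializationAt E' (TangentSpace I' : N → Type _) (φ x)
  let b := Module.finBasis ℝ E'
  let O := U ∩ φ ⁻¹' t.baseSet
  have hO : IsOpen O := hU.inter (t.open_baseSet.preimage hφ.continuous)
  have hxt : φ x ∈ t.baseSet := mem_baseSet_trivializationAt' (φ x)
  have hxO : x ∈ O := ⟨hx, hxt⟩
  replace hX : CMDiff[O] ∞ (T% X) := hX.mono Set.inter_subset_left
  have hE (a) : CMDiff[t.baseSet] ∞ (T% (t.localFrame b a)) :=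
    t.contMDiffOn_localFrame_baseSet ∞ b a
  have hEφ (a) : IsSmoothAlong I φ (fun y ↦ t.localFrame b a (φ y)) O :=
    .comp hφ (hE a) fun y hy ↦ hy.2
  let c (W : Π y : M, TangentSpace I' (φ y)) (a) (y : M) : ℝ := b.repr (t ⟨φ y, W y⟩).2 a
  have hc {W : Π y : M, TangentSpace I' (φ y)} (hW : IsSmoothAlong I φ W O) (a) :
      CMDiff[O] ∞ (c W a) := by
    have h1 : CMDiff[O] ∞ (fun y ↦ (t ⟨φ y, W y⟩).2) := fun y hy ↦
      ((t.contMDiffWithinAt_iff (IB := I') hy.2).1 (hW y hy)).2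
    exact ((b.coord a).toContinuousLinearMap.contDiff.contMDiff (n := ∞)).comp_contMDiffOn h1
  have hsum (W : Π y : M, TangentSpace I' (φ y)) {y : M} (hy : y ∈ O) :
      W y = ∑ a, c W a y • t.localFrame b a (φ y) := by
    have h := (t.basisAt b hy.2).sum_repr (W y)
    conv_lhs => rw [← h]
    refine Finset.sum_congr rfl fun a _ ↦ ?_
    rw [t.localFrame_apply_of_mem_baseSet b hy.2]
    simp [c, Bundle.Trivialization.basisAt]
  have hVO : IsSmoothAlong I φ V O := hV.mono Set.inter_subset_left
  have hdφ := IsSmoothAlong.mfderiv_apply hφ hX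
  have hΓ (a) : IsSmoothAlong I φ (fun y ↦ ∑ d, c (fun y ↦ mfderiv I I' φ y (X y)) d y •
      gN.leviCivita (t.localFrame b a) (φ y) (t.localFrame b d (φ y))) O :=
    .sum_smul hφ (hc hdφ) fun d ↦ .comp (W := fun z ↦ gN.leviCivita (t.localFrame b a) z
      (t.localFrame b d z)) hφ (gN.contMDiffOn_leviCivita t.open_baseSet (hE d) (hE a))
        fun y hy ↦ hy.2
  have key : IsSmoothAlong I φ (fun y ↦ pullbackConnection gN.leviCivita φ V y (X y)) O := by
    refine (((IsSmoothAlong.sum_smul hφ (hc hVO) hΓ).add hφ (IsSmoothAlong.sum_smul hφ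
      (fun a ↦ (hc hVO a).mvfderiv_apply hO hX) hEφ))).congr fun y hy ↦ ?_
    have h1 : ∀ᶠ z in nhds y, V z = ∑ a, c V a z • t.localFrame b a (φ z) := by
      filter_upwards [hO.mem_nhds hy] with z hz using hsum V hz
    rw [pullbackConnection_congr h1, pullbackConnection_sum_smul hφ hO Finset.univ (hc hVO) hEφ hy,
      Finset.sum_add_distrib, Pi.add_apply]
    congr 1
    refine Finset.sum_congr rfl fun a _ ↦ ?_
    rw [pullbackConnection_comp _ (hφ.mdifferentiableAt (by simp))
      (((hE a).contMDiffAt (t.open_baseSet.mem_nhds hy.2)).mdifferentiableAt (by simp)),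
      ContinuousLinearMap.comp_apply, hsum (fun y ↦ mfderiv I I' φ y (X y)) hy]
    simp
  exact (ContMDiffOn.contMDiffAt key (hO.mem_nhds hxO)).contMDiffWithinAt

end PullbackConnection

end AlongMap

/-! ### Pseudo-orthonormal frames and the metric trace -/

section Frame

variable {E : Type*} [NormedAddCommGroup E] [NormedSpace ℝ E] [FiniteDimensional ℝ E]
  {H : Type*} [TopologicalSpace H] {I : ModelWithCorners ℝ E H}
  {M : Type*} [TopologicalSpace M] [ChartedSpace H M] [IsManifold I ∞ M] {p m : ℕ}

lemma frameSign_mul_self (p : ℕ) {m : ℕ} (i : Fin m) : frameSign p i * frameSign p i = 1 := by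
  unfold frameSign
  split_ifs <;> norm_num

namespace IsPseudoOrthonormalFrame

variable {gM : PseudoRiemannianMetric I M p} {e : Fin m → Π x : M, TangentSpace I x} {U : Set M}

lemma mono (he : IsPseudoOrthonormalFrame gM e U) {V : Set M} (hV : IsOpen V) (h : V ⊆ U) :
    IsPseudoOrthonormalFrame gM e V :=
  ⟨hV, fun i ↦ (he.contMDiffOn i).mono h, fun x hx ↦ he.val_eq x (h hx)⟩

variable (gM e) in
/-- The component `ε_j ⟨Y, e_j⟩` of a vector field `Y` along `e_j`. -/
def _root_.frameCoeff (Y : Π y : M, TangentSpace I y) (j : Fin m) (y : M) : ℝ :=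
  frameSign p j * gM.val y (Y y) (e j y)

lemma contMDiffOn_frameCoeff (he : IsPseudoOrthonormalFrame gM e U) {Y : Π y : M, TangentSpace I y}
    (hY : CMDiff[U] ∞ (T% Y)) (j : Fin m) : CMDiff[U] ∞ (frameCoeff gM e Y j) :=
  contMDiffOn_const.mul (gM.contMDiffOn_pairing hY (he.contMDiffOn j))

/-- The expansion of a tangent vector in a pseudo-orthonormal frame. -/
lemma sum_smul (he : IsPseudoOrthonormalFrame gM e U) (hm : Module.finrank ℝ E = m) {x : M}
    (hx : x ∈ U) (u : TangentSpace I x) :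
    ∑ j, (frameSign p j * gM.val x u (e j x)) • e j x = u := by
  have hli : LinearIndependent ℝ (fun j ↦ e j x) := by
    refine Fintype.linearIndependent_iff.2 fun c hc i ↦ ?_
    have h := congr(gM.val x $hc (e i x))
    simp only [map_sum, map_smul, FunLike.coe_sum, Finset.sum_apply, smul_apply, smul_eq_mul,
      he.val_eq x hx, mul_ite, mul_zero, map_zero, zero_apply, Finset.sum_ite_eq',
      Finset.mem_univ, if_true] at h
    have := congr($h * frameSign p i)
    rwa [mul_assoc, frameSign_mul_self, mul_one, zero_mul] at this
  have hcard : Fintype.card (Fin m) = Module.finrank ℝ (TangentSpace I x) := by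
    rw [Fintype.card_fin]
    exact hm.symm
  let b := basisOfLinearIndependentOfCardEqFinrank' _ hli hcard
  have hb (j) : b j = e j x := by simp [b]
  have hu := b.sum_repr u
  simp only [hb] at hu
  have hcoeff (j) : frameSign p j * gM.val x u (e j x) = b.repr u j := by
    conv_lhs => rw [← hu]
    simp only [map_sum, map_smul, FunLike.coe_sum, Finset.sum_apply, smul_apply, smul_eq_mul,
      he.val_eq x hx, mul_ite, mul_zero, Finset.sum_ite_eq', Finset.mem_univ, if_true]
    rw [mul_left_comm, frameSign_mul_self, mul_one]
  simp only [hcoeff, hu]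

lemma frameCoeff_self (he : IsPseudoOrthonormalFrame gM e U) {x : M} (hx : x ∈ U) (i j : Fin m) :
    frameCoeff gM e (e i) j x = if i = j then 1 else 0 := by
  rw [frameCoeff, he.val_eq x hx]
  split_ifs with h
  · rw [h, frameSign_mul_self]
  · simp

variable (gM e) in
/-- The bilinear map on `T_xM` with components `b j k` in the frame: at points
where `e` is pseudo-orthonormal, its value at `e_j, e_k` is `b j k`. -/
def _root_.frameBilin (x : M) {A : Type*} [AddCommGroup A] [Module ℝ A] (b : Fin m → Fin m → A) :
    TangentSpace I x →ₗ[ℝ] TangentSpace I x →ₗ[ℝ] A :=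
  LinearMap.mk₂ ℝ (fun u v ↦ ∑ j, ∑ k, ((frameSign p j * gM.val x u (e j x)) *
      (frameSign p k * gM.val x v (e k x))) • b j k)
    (fun u u' v ↦ by
      simp only [map_add, add_apply, mul_add, add_mul, add_smul, Finset.sum_add_distrib])
    (fun a u v ↦ by
      simp only [map_smul, smul_apply, smul_eq_mul, Finset.smul_sum, smul_smul]
      refine Finset.sum_congr rfl fun j _ ↦ Finset.sum_congr rfl fun k _ ↦ ?_
      congr 1
      ring)
    (fun u v v' ↦ by
      simp only [map_add, add_apply, mul_add, add_smul, Finset.sum_add_distrib])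
    (fun a u v ↦ by
      simp only [map_smul, smul_apply, smul_eq_mul, Finset.smul_sum, smul_smul]
      refine Finset.sum_congr rfl fun j _ ↦ Finset.sum_congr rfl fun k _ ↦ ?_
      congr 1
      ring)

lemma _root_.frameBilin_apply (x : M) {A : Type*} [AddCommGroup A] [Module ℝ A]
    (b : Fin m → Fin m → A) (u v : TangentSpace I x) :
    frameBilin gM e x b u v = ∑ j, ∑ k, ((frameSign p j * gM.val x u (e j x)) *
      (frameSign p k * gM.val x v (e k x))) • b j k := rfl

lemma frameBilin_frame (he : IsPseudoOrthonormalFrame gM e U) {x : M} (hx : x ∈ U) {A : Type*}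
    [AddCommGroup A] [Module ℝ A] (b : Fin m → Fin m → A) (j k : Fin m) :
    frameBilin gM e x b (e j x) (e k x) = b j k := by
  have h (i j : Fin m) : frameSign p j * gM.val x (e i x) (e j x) = if i = j then 1 else 0 :=
    he.frameCoeff_self hx i j
  simp [frameBilin_apply, h]

/-- The metric trace of a bilinear map, computed in a pseudo-orthonormal frame. -/
lemma trace_eq (he : IsPseudoOrthonormalFrame gM e U) {x : M}
    (hx : x ∈ U) {A : Type*} [AddCommGroup A] [Module ℝ A]
    {B : TangentSpace I x → TangentSpace I x → A} {b : Fin m → Fin m → A}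
    (hB : ∀ u v, B u v = frameBilin gM e x b u v) :
    gM.trace x B = ∑ j, frameSign p j • b j j := by
  set f := Module.finBasis ℝ (TangentSpace I x)
  set f' := (gM.val x).toBilinForm.dualBasis (gM.bilinForm_nondegenerate x) f
  have hexp (u : TangentSpace I x) : ∑ i, gM.val x (f' i) u • f i = u := by
    conv_rhs => rw [← f.sum_repr u]
    refine Finset.sum_congr rfl fun i _ ↦ ?_
    congr 1
    conv_lhs => rw [← f.sum_repr u]
    have h (j) : gM.val x (f' i) (f j) = if j = i then 1 else 0 :=
      LinearMap.BilinForm.apply_dualBasis_left (gM.bilinForm_nondegenerate x) f i j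
    simp only [map_sum, map_smul, h, smul_eq_mul, mul_ite, mul_one, mul_zero, Finset.sum_ite_eq',
      Finset.mem_univ, if_true]
  have hdual (u v : TangentSpace I x) :
      ∑ i, gM.val x (f i) u * gM.val x (f' i) v = gM.val x v u := by
    conv_rhs => rw [← hexp v]
    simp [mul_comm]
  have h1 : gM.trace x B = ∑ j, ∑ k, (∑ i, (frameSign p j * gM.val x (f i) (e j x)) *
      (frameSign p k * gM.val x (f' i) (e k x))) • b j k := by
    unfold PseudoRiemannianMetric.trace
    simp only [hB, frameBilin_apply]
    rw [Finset.sum_comm]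
    refine Finset.sum_congr rfl fun j _ ↦ ?_
    rw [Finset.sum_comm]
    exact Finset.sum_congr rfl fun k _ ↦ (Finset.sum_smul ..).symm
  rw [h1]
  refine Finset.sum_congr rfl fun j _ ↦ ?_
  have h2 (k) : ∑ i, (frameSign p j * gM.val x (f i) (e j x)) *
      (frameSign p k * gM.val x (f' i) (e k x)) = if k = j then frameSign p j else 0 := by
    rw [Finset.sum_congr rfl fun i _ ↦ show _ = (frameSign p j * frameSign p k) *
      (gM.val x (f i) (e j x) * gM.val x (f' i) (e k x)) by ring, ← Finset.mul_sum, hdual,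
      he.val_eq x hx]
    split_ifs with h
    · rw [h, frameSign_mul_self, one_mul]
    · simp
  simp [h2]

/-- The connection matrix `⟨∇_v e_j, e_k⟩` of a pseudo-orthonormal frame is antisymmetric. -/
lemma val_leviCivita_antisymm (he : IsPseudoOrthonormalFrame gM e U) {x : M} (hx : x ∈ U)
    (v : TangentSpace I x) (j k : Fin m) :
    gM.val x (gM.leviCivita (e j) x v) (e k x) = - gM.val x (gM.leviCivita (e k) x v) (e j x) := by
  have hd (i) : MDiffAt (T% (e i)) x :=
    ((he.contMDiffOn i).contMDiffAt (he.isOpen.mem_nhds hx)).mdifferentiableAt (by simp)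
  have h0 : d% (gM.pairing (e j) (e k)) x = 0 := by
    rw [mvfderiv_eq_of_eventuallyEq (f' := fun _ ↦ if j = k then frameSign p j else 0),
      mvfderiv_const]
    filter_upwards [he.isOpen.mem_nhds hx] with y hy using he.val_eq y hy j k
  have h := gM.leviCivita_metric (hd j) (hd k) v
  rw [h0, zero_apply, gM.symm x (e j x)] at h
  linarith

/-- The covariant derivative of a vector field, written out in a pseudo-orthonormal frame. -/
lemma leviCivita_eq_sum (he : IsPseudoOrthonormalFrame gM e U) (hm : Module.finrank ℝ E = m)
    {Y : Π y : M, TangentSpace I y} (hY : CMDiff[U] ∞ (T% Y)) {x : M} (hx : x ∈ U)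
    (v : TangentSpace I x) :
    gM.leviCivita Y x v = ∑ j, (frameCoeff gM e Y j x • gM.leviCivita (e j) x v +
      d% (frameCoeff gM e Y j) x v • e j x) := by
  have hYe : ∀ᶠ y in nhds x, Y y = (∑ j, frameCoeff gM e Y j • e j) y := by
    filter_upwards [he.isOpen.mem_nhds hx] with y hy
    simp only [Finset.sum_apply, Pi.smul_apply']
    exact (he.sum_smul hm hy (Y y)).symm
  have hc := gM.leviCivita.isCovariantDerivativeOnUniv
  have hd (i) : MDiffAt (T% (e i)) x :=
    ((he.contMDiffOn i).contMDiffAt (he.isOpen.mem_nhds hx)).mdifferentiableAt (by simp)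
  have hf (i) : MDiffAt (frameCoeff gM e Y i) x := ((he.contMDiffOn_frameCoeff hY i).contMDiffAt
    (he.isOpen.mem_nhds hx)).mdifferentiableAt (by simp)
  have hfd (i) : MDiffAt (T% (frameCoeff gM e Y i • e i)) x := (hf i).smul_section (hd i)
  rw [gM.leviCivita_congr hYe]
  have key (s : Finset (Fin m)) : MDiffAt (T% (∑ j ∈ s, frameCoeff gM e Y j • e j)) x ∧
      gM.leviCivita (∑ j ∈ s, frameCoeff gM e Y j • e j) x v =
      ∑ j ∈ s, (frameCoeff gM e Y j x • gM.leviCivita (e j) x v +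
        d% (frameCoeff gM e Y j) x v • e j x) := by
    induction s using Finset.induction_on with
    | empty =>
      refine ⟨mdifferentiableAt_zeroSection .., ?_⟩
      rw [Finset.sum_empty, Finset.sum_empty, gM.leviCivita.zero]
      rfl
    | insert i s hi ih =>
      rw [Finset.sum_insert hi, Finset.sum_insert hi]
      refine ⟨mdifferentiableAt_add_section (hfd i) ih.1, ?_⟩
      rw [hc.add (hfd i) ih.1, hc.leibniz (hd i) (hf i), add_apply, ih.2]
      simp
  exact (key Finset.univ).2

end IsPseudoOrthonormalFrame

end Frame

/-! ### Covariant derivatives of `φ⁻¹TN`-valued bilinear tensors -/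

section Tensor

variable {E : Type*} [NormedAddCommGroup E] [NormedSpace ℝ E] [FiniteDimensional ℝ E]
  {H : Type*} [TopologicalSpace H] {I : ModelWithCorners ℝ E H}
  {M : Type*} [TopologicalSpace M] [ChartedSpace H M] [IsManifold I ∞ M] {p m : ℕ}
  {E' : Type*} [NormedAddCommGroup E'] [NormedSpace ℝ E'] [FiniteDimensional ℝ E']
  {H' : Type*} [TopologicalSpace H'] {I' : ModelWithCorners ℝ E' H'}
  {N : Type*} [TopologicalSpace N] [ChartedSpace H' N] [IsManifold I' ∞ N] {q : ℕ}
  {gM : PseudoRiemannianMetric I M p} {gN : PseudoRiemannianMetric I' N q} {φ : M → N}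
  {e : Fin m → Π x : M, TangentSpace I x} {U : Set M}

variable (gM e U) in
/-- The operation `T` on pairs of vector fields is, on the open set `U` with frame `e`, a smooth
`φ⁻¹TN`-valued tensor field of type `(0, 2)`: its components are smooth and determine its value on
smooth vector fields. -/
structure IsFrameTensor
    (T : (Π y : M, TangentSpace I y) → (Π y : M, TangentSpace I y) → Π y : M, TangentSpace I' (φ y)) :
    Prop where
  eq_frameBilin {Y Z : Π y : M, TangentSpace I y} (hY : CMDiff[U] ∞ (T% Y))
    (hZ : CMDiff[U] ∞ (T% Z)) {y : M} (hy : y ∈ U) :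
    T Y Z y = frameBilin gM e y (fun j k ↦ T (e j) (e k) y) (Y y) (Z y)
  isSmoothAlong (j k : Fin m) : IsSmoothAlong I φ (T (e j) (e k)) U

variable (gM gN) in
/-- The covariant derivative `∇̄_X (T(Y, Z)) - T(∇_X Y, Z) - T(Y, ∇_X Z)` of a `φ⁻¹TN`-valued tensor
field `T` of type `(0, 2)`. -/
def tensorDeriv
    (T : (Π y : M, TangentSpace I y) → (Π y : M, TangentSpace I y) → Π y : M, TangentSpace I' (φ y))
    (X Y Z : Π y : M, TangentSpace I y) (x : M) : TangentSpace I' (φ x) :=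
  pullbackConnection gN.leviCivita φ (T Y Z) x (X x)
    - T (fun y ↦ gM.leviCivita Y y (X y)) Z x - T Y (fun y ↦ gM.leviCivita Z y (X y)) x

namespace IsFrameTensor

variable
  {T : (Π y : M, TangentSpace I y) → (Π y : M, TangentSpace I y) → Π y : M, TangentSpace I' (φ y)}

lemma isSmoothAlong_apply (hT : IsFrameTensor gM e U T) (hφ : ContMDiff I I' ∞ φ)
    (he : IsPseudoOrthonormalFrame gM e U) {Y Z : Π y : M, TangentSpace I y}
    (hY : CMDiff[U] ∞ (T% Y)) (hZ : CMDiff[U] ∞ (T% Z)) : IsSmoothAlong I φ (T Y Z) U := by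
  refine (IsSmoothAlong.sum_smul (ι := Fin m × Fin m) hφ
    (fun i ↦ (he.contMDiffOn_frameCoeff hY i.1).mul (he.contMDiffOn_frameCoeff hZ i.2))
    (fun i ↦ hT.isSmoothAlong i.1 i.2)).congr fun y hy ↦ ?_
  rw [hT.eq_frameBilin hY hZ hy, frameBilin_apply,
    Fintype.sum_prod_type]
  rfl

/-- The covariant derivative of a tensor is a tensor. -/
theorem tensorDeriv (hT : IsFrameTensor gM e U T) (hφ : ContMDiff I I' ∞ φ)
    (he : IsPseudoOrthonormalFrame gM e U) (hm : Module.finrank ℝ E = m)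
    {X : Π y : M, TangentSpace I y} (hX : CMDiff[U] ∞ (T% X)) :
    IsFrameTensor gM e U (tensorDeriv gM gN T X) where
  isSmoothAlong j k := by
    have h (i) := gM.contMDiffOn_leviCivita he.isOpen hX (he.contMDiffOn i)
    exact ((isSmoothAlong_pullbackConnection gN hφ he.isOpen (hT.isSmoothAlong j k) hX).sub hφ
      (hT.isSmoothAlong_apply hφ he (h j) (he.contMDiffOn k))).sub hφ
      (hT.isSmoothAlong_apply hφ he (he.contMDiffOn j) (h k))
  eq_frameBilin {Y Z} hY hZ {x} hx := by
    have hd {W : Π y : M, TangentSpace I y} (hW : CMDiff[U] ∞ (T% W)) :=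
      gM.contMDiffOn_leviCivita he.isOpen hX hW
    set β := frameBilin gM e x (fun j k ↦ T (e j) (e k) x) with hβ
    have hYc (j) := he.contMDiffOn_frameCoeff hY j
    have hZc (j) := he.contMDiffOn_frameCoeff hZ j
    have hmd {f : M → ℝ} (hf : CMDiff[U] ∞ f) : MDiffAt f x :=
      (hf.contMDiffAt (he.isOpen.mem_nhds hx)).mdifferentiableAt (by simp)
    have hYx : Y x = ∑ j, frameCoeff gM e Y j x • e j x := (he.sum_smul hm hx (Y x)).symm
    have hZx : Z x = ∑ j, frameCoeff gM e Z j x • e j x := (he.sum_smul hm hx (Z x)).symm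
    have h1 : pullbackConnection gN.leviCivita φ (T Y Z) x (X x) = ∑ j, ∑ k,
        ((frameCoeff gM e Y j x * frameCoeff gM e Z k x) •
          pullbackConnection gN.leviCivita φ (T (e j) (e k)) x (X x) +
        (frameCoeff gM e Y j x * d% (frameCoeff gM e Z k) x (X x) +
          frameCoeff gM e Z k x * d% (frameCoeff gM e Y j) x (X x)) • T (e j) (e k) x) := by
      have hev : ∀ᶠ y in nhds x, T Y Z y = ∑ i : Fin m × Fin m,
          (frameCoeff gM e Y i.1 * frameCoeff gM e Z i.2) y • T (e i.1) (e i.2) y := by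
        filter_upwards [he.isOpen.mem_nhds hx] with y hy
        rw [hT.eq_frameBilin hY hZ hy, frameBilin_apply,
          Fintype.sum_prod_type]
        rfl
      rw [pullbackConnection_congr hev, pullbackConnection_sum_smul (ι := Fin m × Fin m) hφ he.isOpen
        Finset.univ (fun i ↦ (hYc i.1).mul (hZc i.2)) (fun i ↦ hT.isSmoothAlong i.1 i.2) hx,
        Fintype.sum_prod_type]
      refine Finset.sum_congr rfl fun j _ ↦ Finset.sum_congr rfl fun k _ ↦ ?_
      rw [mvfderiv_mul (hmd (hYc j)) (hmd (hZc k))]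
      rfl
    have h2 : T (fun y ↦ gM.leviCivita Y y (X y)) Z x = ∑ j, ∑ k,
        ((frameCoeff gM e Y j x * frameCoeff gM e Z k x) • β (gM.leviCivita (e j) x (X x)) (e k x) +
        (frameCoeff gM e Z k x * d% (frameCoeff gM e Y j) x (X x)) • T (e j) (e k) x) := by
      rw [hT.eq_frameBilin (hd hY) hZ hx, he.leviCivita_eq_sum hm hY hx, hZx, ← hβ]
      simp only [map_sum, map_add, map_smul, LinearMap.sum_apply, LinearMap.add_apply,
        LinearMap.smul_apply, β, he.frameBilin_frame hx]
      rw [Finset.sum_comm]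
      refine Finset.sum_congr rfl fun j _ ↦ ?_
      simp only [Finset.smul_sum, smul_add]
      refine Finset.sum_congr rfl fun k _ ↦ ?_
      module
    have h3 : T Y (fun y ↦ gM.leviCivita Z y (X y)) x = ∑ j, ∑ k,
        ((frameCoeff gM e Y j x * frameCoeff gM e Z k x) • β (e j x) (gM.leviCivita (e k) x (X x)) +
        (frameCoeff gM e Y j x * d% (frameCoeff gM e Z k) x (X x)) • T (e j) (e k) x) := by
      rw [hT.eq_frameBilin hY (hd hZ) hx, he.leviCivita_eq_sum hm hZ hx, hYx, ← hβ]
      simp only [map_sum, map_add, map_smul, LinearMap.sum_apply, LinearMap.smul_apply, β,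
        he.frameBilin_frame hx]
      rw [Finset.sum_comm]
      simp only [Finset.smul_sum, ← Finset.sum_add_distrib]
      refine Finset.sum_congr rfl fun j _ ↦ Finset.sum_congr rfl fun k _ ↦ ?_
      module
    rw [_root_.tensorDeriv, h1, h2, h3, frameBilin_apply]
    simp only [← Finset.sum_sub_distrib]
    refine Finset.sum_congr rfl fun j _ ↦ Finset.sum_congr rfl fun k _ ↦ ?_
    rw [_root_.tensorDeriv, hT.eq_frameBilin (hd (he.contMDiffOn j)) (he.contMDiffOn k) hx,
      hT.eq_frameBilin (he.contMDiffOn j) (hd (he.contMDiffOn k)) hx, ← hβ]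
    simp only [frameCoeff]
    module

/-- The metric trace commutes with the covariant derivative: the correction terms cancel since the
connection matrix of the frame is antisymmetric. -/
theorem sum_tensorDeriv (hT : IsFrameTensor gM e U T) (hφ : ContMDiff I I' ∞ φ)
    (he : IsPseudoOrthonormalFrame gM e U)
    {X : Π y : M, TangentSpace I y} (hX : CMDiff[U] ∞ (T% X)) {x : M} (hx : x ∈ U) :
    ∑ j, frameSign p j • _root_.tensorDeriv gM gN T X (e j) (e j) x =
      pullbackConnection gN.leviCivita φ (fun y ↦ ∑ j, frameSign p j • T (e j) (e j) y) x (X x) := by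
  have hd (j) := gM.contMDiffOn_leviCivita he.isOpen hX (he.contMDiffOn j)
  rw [pullbackConnection_sum_smul (f := fun j _ ↦ frameSign p j) hφ he.isOpen Finset.univ
    (fun j ↦ contMDiffOn_const) (fun j ↦ hT.isSmoothAlong j j) hx]
  simp only [mvfderiv_const, zero_apply, zero_smul, add_zero]
  let A (j k : Fin m) : ℝ := frameSign p j * frameSign p k *
    gM.val x (gM.leviCivita (e j) x (X x)) (e k x)
  have hA (j k) : A j k = - A k j := by
    simp only [A]
    rw [he.val_leviCivita_antisymm hx]
    ring
  have hself (i j : Fin m) : frameSign p j * gM.val x (e i x) (e j x) = if i = j then 1 else 0 :=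
    he.frameCoeff_self hx i j
  have h1 (j) : frameSign p j • T (fun y ↦ gM.leviCivita (e j) y (X y)) (e j) x =
      ∑ k, A j k • T (e k) (e j) x := by
    rw [hT.eq_frameBilin (hd j) (he.contMDiffOn j) hx, frameBilin_apply]
    simp [hself, A, smul_smul, mul_assoc, Finset.smul_sum]
  have h2 (j) : frameSign p j • T (e j) (fun y ↦ gM.leviCivita (e j) y (X y)) x =
      ∑ k, A j k • T (e j) (e k) x := by
    rw [hT.eq_frameBilin (he.contMDiffOn j) (hd j) hx, frameBilin_apply]
    simp [hself, A, smul_smul, mul_assoc, Finset.smul_sum]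
  have h3 : ∑ j, ∑ k, A j k • T (e k) (e j) x = - ∑ j, ∑ k, A j k • T (e j) (e k) x := by
    rw [Finset.sum_comm]
    simp only [← Finset.sum_neg_distrib]
    refine Finset.sum_congr rfl fun j _ ↦ Finset.sum_congr rfl fun k _ ↦ ?_
    rw [hA k j, neg_smul]
  simp only [_root_.tensorDeriv, smul_sub, Finset.sum_sub_distrib, h1, h2, h3]
  abel

end IsFrameTensor

/-! ### Covariant derivatives of `φ⁻¹TN`-valued one-forms -/

section OneForm

variable {α : Π y : M, TangentSpace I y →L[ℝ] TangentSpace I' (φ y)}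

theorem isFrameTensor_oneFormDeriv (hφ : ContMDiff I I' ∞ φ)
    (he : IsPseudoOrthonormalFrame gM e U) (hm : Module.finrank ℝ E = m)
    (hα : ∀ k, IsSmoothAlong I φ (fun y ↦ α y (e k y)) U) :
    IsFrameTensor gM e U (oneFormDeriv gM gN φ α) := by
  have hsum (Y : Π y : M, TangentSpace I y) {y : M} (hy : y ∈ U) :
      α y (Y y) = ∑ k, frameCoeff gM e Y k y • α y (e k y) := by
    conv_lhs => rw [← he.sum_smul hm hy (Y y)]
    simp only [map_sum, map_smul]
    rfl
  refine ⟨fun {Y Z} hY hZ {x} hx ↦ ?_, fun j k ↦ ?_⟩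
  · have hev : ∀ᶠ y in nhds x, α y (Z y) = ∑ k, frameCoeff gM e Z k y • α y (e k y) := by
      filter_upwards [he.isOpen.mem_nhds hx] with y hy using hsum Z hy
    have h1 : oneFormDeriv gM gN φ α Y Z x =
        ∑ k, frameCoeff gM e Z k x • oneFormDeriv gM gN φ α Y (e k) x := by
      unfold oneFormDeriv
      rw [pullbackConnection_congr hev, pullbackConnection_sum_smul hφ he.isOpen Finset.univ
        (he.contMDiffOn_frameCoeff hZ) hα hx, he.leviCivita_eq_sum hm hZ hx, map_sum,
        ← Finset.sum_sub_distrib]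
      refine Finset.sum_congr rfl fun k _ ↦ ?_
      rw [map_add, map_smul, map_smul]
      module
    have h2 (k) : oneFormDeriv gM gN φ α Y (e k) x =
        ∑ j, frameCoeff gM e Y j x • oneFormDeriv gM gN φ α (e j) (e k) x := by
      have hYx : Y x = ∑ j, frameCoeff gM e Y j x • e j x := (he.sum_smul hm hx (Y x)).symm
      unfold oneFormDeriv
      rw [hYx]
      simp only [map_sum, map_smul, smul_sub, Finset.sum_sub_distrib]
    rw [h1, frameBilin_apply, Finset.sum_comm]
    refine Finset.sum_congr rfl fun k _ ↦ ?_
    rw [h2, Finset.smul_sum]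
    refine Finset.sum_congr rfl fun j _ ↦ ?_
    rw [smul_smul, mul_comm]
    rfl
  · have hd := gM.contMDiffOn_leviCivita he.isOpen (he.contMDiffOn j) (he.contMDiffOn k)
    refine (isSmoothAlong_pullbackConnection gN hφ he.isOpen (hα k) (he.contMDiffOn j)).sub hφ
      ((IsSmoothAlong.sum_smul hφ (he.contMDiffOn_frameCoeff hd) hα).congr fun y hy ↦ ?_)
    exact hsum (fun y ↦ gM.leviCivita (e k) y (e j y)) hy

/-- The metric trace of `∇̃α` in a pseudo-orthonormal frame. -/
theorem oneFormDivergence_eq (hφ : ContMDiff I I' ∞ φ)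
    (he : IsPseudoOrthonormalFrame gM e U) (hm : Module.finrank ℝ E = m)
    (hα : ∀ k, IsSmoothAlong I φ (fun y ↦ α y (e k y)) U) {x : M} (hx : x ∈ U) :
    oneFormDivergence gM gN φ α x =
      ∑ j, frameSign p j • oneFormDeriv gM gN φ α (e j) (e j) x := by
  refine he.trace_eq hx (b := fun j k ↦ oneFormDeriv gM gN φ α (e j) (e k) x) fun u v ↦ ?_
  -- the constant extensions of `u` and `v` are smooth only near `x`
  obtain ⟨s, hs, hus⟩ := exists_contMDiffOn_extend (k := ∞) I E u
  obtain ⟨t, ht, hvt⟩ := exists_contMDiffOn_extend (k := ∞) I E v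
  have hx' : x ∈ U ∩ interior (s ∩ t) :=
    ⟨hx, mem_interior_iff_mem_nhds.2 (Filter.inter_mem hs ht)⟩
  have hsub : U ∩ interior (s ∩ t) ⊆ s ∩ t := Set.inter_subset_right.trans interior_subset
  have he' := he.mono (he.isOpen.inter isOpen_interior) (Set.inter_subset_left (t := interior (s ∩ t)))
  have h := (isFrameTensor_oneFormDeriv (gN := gN) hφ he' hm
    fun k ↦ (hα k).mono Set.inter_subset_left).eq_frameBilin
    (hus.mono (hsub.trans Set.inter_subset_left)) (hvt.mono (hsub.trans Set.inter_subset_right)) hx'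
  simpa using h

end OneForm

end Tensor

/-! ### The curvature tensor of a Levi-Civita connection -/

section Curvature

variable {E : Type*} [NormedAddCommGroup E] [NormedSpace ℝ E] [FiniteDimensional ℝ E]
  {H : Type*} [TopologicalSpace H] {I : ModelWithCorners ℝ E H}
  {M : Type*} [TopologicalSpace M] [ChartedSpace H M] [IsManifold I ∞ M] {p : ℕ}

namespace PseudoRiemannianMetric

variable (g : PseudoRiemannianMetric I M p)

lemma mdifferentiableAt_leviCivita_extend (x : M) (v w : TangentSpace I x) :
    MDiffAt (T% (fun y ↦ g.leviCivita (extend E w) y (extend E v y))) x := by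
  obtain ⟨s, hs, hv⟩ := exists_contMDiffOn_extend (k := ∞) I E v
  obtain ⟨t, ht, hw⟩ := exists_contMDiffOn_extend (k := ∞) I E w
  have hx : interior (s ∩ t) ∈ nhds x := interior_mem_nhds.2 (Filter.inter_mem hs ht)
  have hsub : interior (s ∩ t) ⊆ s ∩ t := interior_subset
  exact ((g.contMDiffOn_leviCivita isOpen_interior (hv.mono (hsub.trans Set.inter_subset_left))
    (hw.mono (hsub.trans Set.inter_subset_right))).contMDiffAt hx).mdifferentiableAt (by simp)

/-- The second covariant derivative `∇_u ∇_V W` at `x`, where `V` and `W` are the fields which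
extend `v` and `w` with constant coordinates. -/
def secondDeriv (x : M) (u v w : TangentSpace I x) : TangentSpace I x :=
  g.leviCivita (fun y ↦ g.leviCivita (extend E w) y (extend E v y)) x u

lemma curvatureTensor_eq (x : M) (u v w : TangentSpace I x) :
    curvatureTensor g.leviCivita x u v w = g.secondDeriv x u v w - g.secondDeriv x v u w := by
  simp [curvatureTensor, curvatureField, mlieBracket_extend, secondDeriv]

lemma curvatureTensor_swap (x : M) (u v w : TangentSpace I x) :
    curvatureTensor g.leviCivita x u v w = - curvatureTensor g.leviCivita x v u w := by
  rw [curvatureTensor_eq, curvatureTensor_eq, neg_sub]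

lemma secondDeriv_add_mid (x : M) (u v v' w : TangentSpace I x) :
    g.secondDeriv x u (v + v') w = g.secondDeriv x u v w + g.secondDeriv x u v' w := by
  have h : ∀ᶠ y in nhds x, g.leviCivita (extend E w) y (extend E (v + v') y) =
      ((fun y ↦ g.leviCivita (extend E w) y (extend E v y)) +
        (fun y ↦ g.leviCivita (extend E w) y (extend E v' y))) y := by
    filter_upwards [extend_add v v'] with y hy
    rw [hy, map_add, Pi.add_apply]
  rw [secondDeriv, g.leviCivita_congr h, g.leviCivita.isCovariantDerivativeOnUniv.add
    (g.mdifferentiableAt_leviCivita_extend x v w) (g.mdifferentiableAt_leviCivita_extend x v' w),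
    add_apply, secondDeriv, secondDeriv]

lemma secondDeriv_smul_mid (x : M) (a : ℝ) (u v w : TangentSpace I x) :
    g.secondDeriv x u (a • v) w = a • g.secondDeriv x u v w := by
  have h : ∀ᶠ y in nhds x, g.leviCivita (extend E w) y (extend E (a • v) y) =
      (a • (fun y ↦ g.leviCivita (extend E w) y (extend E v y))) y := by
    filter_upwards [extend_smul a v] with y hy
    rw [hy, map_smul, Pi.smul_apply]
  rw [secondDeriv, g.leviCivita_congr h, g.leviCivita.isCovariantDerivativeOnUniv.smul_const a
    (g.mdifferentiableAt_leviCivita_extend x v w), smul_apply, secondDeriv]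

lemma eventually_mdifferentiableAt_extend {x : M} (w : TangentSpace I x) :
    ∀ᶠ y in nhds x, MDiffAt (T% (extend E w)) y := by
  obtain ⟨s, hs, hw⟩ := exists_contMDiffOn_extend (k := ∞) I E w
  filter_upwards [eventually_mem_nhds_iff.2 hs] with y hy
  exact (hw.contMDiffAt hy).mdifferentiableAt (by simp)

lemma secondDeriv_add_right (x : M) (u v w w' : TangentSpace I x) :
    g.secondDeriv x u v (w + w') = g.secondDeriv x u v w + g.secondDeriv x u v w' := by
  have h : ∀ᶠ y in nhds x, g.leviCivita (extend E (w + w')) y (extend E v y) =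
      ((fun y ↦ g.leviCivita (extend E w) y (extend E v y)) +
        (fun y ↦ g.leviCivita (extend E w') y (extend E v y))) y := by
    filter_upwards [(extend_add w w').eventually_nhds, eventually_mdifferentiableAt_extend w,
      eventually_mdifferentiableAt_extend w'] with y hy h1 h2
    rw [g.leviCivita_congr (Y' := extend E w + extend E w') hy,
      g.leviCivita.isCovariantDerivativeOnUniv.add h1 h2, add_apply, Pi.add_apply]
  rw [secondDeriv, g.leviCivita_congr h, g.leviCivita.isCovariantDerivativeOnUniv.add
    (g.mdifferentiableAt_leviCivita_extend x v w) (g.mdifferentiableAt_leviCivita_extend x v w'),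
    add_apply, secondDeriv, secondDeriv]

lemma secondDeriv_smul_right (x : M) (a : ℝ) (u v w : TangentSpace I x) :
    g.secondDeriv x u v (a • w) = a • g.secondDeriv x u v w := by
  have h : ∀ᶠ y in nhds x, g.leviCivita (extend E (a • w)) y (extend E v y) =
      (a • (fun y ↦ g.leviCivita (extend E w) y (extend E v y))) y := by
    filter_upwards [(extend_smul a w).eventually_nhds,
      eventually_mdifferentiableAt_extend w] with y hy h1
    rw [g.leviCivita_congr (Y' := a • extend E w) hy,
      g.leviCivita.isCovariantDerivativeOnUniv.smul_const a h1, smul_apply, Pi.smul_apply]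
  rw [secondDeriv, g.leviCivita_congr h, g.leviCivita.isCovariantDerivativeOnUniv.smul_const a
    (g.mdifferentiableAt_leviCivita_extend x v w), smul_apply, secondDeriv]

/-- The bilinear map `(u, w) ↦ R(u, v)w`. -/
def curvatureBilin (x : M) (v : TangentSpace I x) :
    TangentSpace I x →ₗ[ℝ] TangentSpace I x →ₗ[ℝ] TangentSpace I x :=
  LinearMap.mk₂ ℝ (fun u w ↦ curvatureTensor g.leviCivita x u v w)
    (fun u u' w ↦ by
      simp only [curvatureTensor_eq, secondDeriv_add_mid]
      rw [secondDeriv, map_add, ← secondDeriv, ← secondDeriv]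
      abel)
    (fun a u w ↦ by
      simp only [curvatureTensor_eq, secondDeriv_smul_mid]
      rw [secondDeriv, map_smul, ← secondDeriv, smul_sub])
    (fun u w w' ↦ by
      simp only [curvatureTensor_eq, secondDeriv_add_right]
      abel)
    (fun a u w ↦ by
      simp only [curvatureTensor_eq, secondDeriv_smul_right, smul_sub])

lemma curvatureBilin_apply (x : M) (u v w : TangentSpace I x) :
    g.curvatureBilin x v u w = curvatureTensor g.leviCivita x u v w := rfl

end PseudoRiemannianMetric

end Curvature

/-! ### The tension field and the bitension field in a frame -/

section Tension

variable {E : Type*} [NormedAddCommGroup E] [NormedSpace ℝ E] [FiniteDimensional ℝ E]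
  {H : Type*} [TopologicalSpace H] {I : ModelWithCorners ℝ E H}
  {M : Type*} [TopologicalSpace M] [ChartedSpace H M] [IsManifold I ∞ M] {p m : ℕ}
  {E' : Type*} [NormedAddCommGroup E'] [NormedSpace ℝ E'] [FiniteDimensional ℝ E']
  {H' : Type*} [TopologicalSpace H'] {I' : ModelWithCorners ℝ E' H'}
  {N : Type*} [TopologicalSpace N] [ChartedSpace H' N] [IsManifold I' ∞ N] {q : ℕ}
  {gM : PseudoRiemannianMetric I M p} {gN : PseudoRiemannianMetric I' N q} {φ : M → N}
  {e : Fin m → Π x : M, TangentSpace I x} {U : Set M}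

namespace IsPseudoOrthonormalFrame

variable (he : IsPseudoOrthonormalFrame gM e U) (hφ : ContMDiff I I' ∞ φ)
  (hm : Module.finrank ℝ E = m)

include he hφ hm

theorem isFrameTensor_secondFundamentalForm :
    IsFrameTensor gM e U (secondFundamentalForm gM gN φ) :=
  isFrameTensor_oneFormDeriv hφ he hm fun k ↦ .mfderiv_apply hφ (he.contMDiffOn k)

theorem isFrameTensor_thirdFundamentalForm {Y : Π y : M, TangentSpace I y}
    (hY : CMDiff[U] ∞ (T% Y)) : IsFrameTensor gM e U (thirdFundamentalForm gM gN φ Y) :=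
  (he.isFrameTensor_secondFundamentalForm hφ hm).tensorDeriv hφ he hm hY

theorem tensionField_eq {x : M} (hx : x ∈ U) :
    tensionField gM gN φ x =
      ∑ j, frameSign p j • secondFundamentalForm gM gN φ (e j) (e j) x :=
  oneFormDivergence_eq hφ he hm (fun k ↦ .mfderiv_apply hφ (he.contMDiffOn k)) hx

lemma isSmoothAlong_tensionField : IsSmoothAlong I φ (tensionField gM gN φ) U :=
  (IsSmoothAlong.sum_smul (f := fun j _ ↦ frameSign p j) hφ (fun _ ↦ contMDiffOn_const) fun j ↦
    (he.isFrameTensor_secondFundamentalForm hφ hm).isSmoothAlong j j).congr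
      fun _ hy ↦ he.tensionField_eq hφ hm hy

/-- The trace of `∇̃²dφ` in its last two arguments is `∇̄τ(φ)`. -/
theorem sum_thirdFundamentalForm {X : Π y : M, TangentSpace I y} (hX : CMDiff[U] ∞ (T% X)) {x : M}
    (hx : x ∈ U) : ∑ j, frameSign p j • thirdFundamentalForm gM gN φ X (e j) (e j) x =
      pullbackConnection gN.leviCivita φ (tensionField gM gN φ) x (X x) := by
  rw [pullbackConnection_congr (W := fun y ↦
    ∑ j, frameSign p j • secondFundamentalForm gM gN φ (e j) (e j) y)]
  · exact (he.isFrameTensor_secondFundamentalForm hφ hm).sum_tensorDeriv hφ he hX hx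
  · filter_upwards [he.isOpen.mem_nhds hx] with y hy using he.tensionField_eq hφ hm hy

/-- The trace of `∇̃³dφ` in its last two arguments is `∇̃∇̄τ(φ)`. -/
theorem sum_fourthFundamentalForm {X Y : Π y : M, TangentSpace I y} (hX : CMDiff[U] ∞ (T% X))
    (hY : CMDiff[U] ∞ (T% Y)) {x : M} (hx : x ∈ U) :
    ∑ j, frameSign p j • fourthFundamentalForm gM gN φ X Y (e j) (e j) x =
      oneFormDeriv gM gN φ (pullbackConnection gN.leviCivita φ (tensionField gM gN φ)) X Y x := by
  have h1 : ∀ᶠ y in nhds x, ∑ j, frameSign p j • thirdFundamentalForm gM gN φ Y (e j) (e j) y =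
      pullbackConnection gN.leviCivita φ (tensionField gM gN φ) y (Y y) := by
    filter_upwards [he.isOpen.mem_nhds hx] with y hy using he.sum_thirdFundamentalForm hφ hm hY hy
  have h2 := (he.isFrameTensor_thirdFundamentalForm (gN := gN) hφ hm hY).sum_tensorDeriv
    (gN := gN) hφ he hX hx
  have h3 (j) : fourthFundamentalForm gM gN φ X Y (e j) (e j) x =
      tensorDeriv gM gN (thirdFundamentalForm gM gN φ Y) X (e j) (e j) x -
        thirdFundamentalForm gM gN φ (fun y ↦ gM.leviCivita Y y (X y)) (e j) (e j) x := by
    rw [fourthFundamentalForm, tensorDeriv]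
    abel
  simp only [h3, smul_sub, Finset.sum_sub_distrib]
  rw [h2, pullbackConnection_congr h1, oneFormDeriv,
    he.sum_thirdFundamentalForm hφ hm (gM.contMDiffOn_leviCivita he.isOpen hX hY) hx]

theorem roughLaplacian_tensionField {x : M} (hx : x ∈ U) :
    roughLaplacian gM gN φ (tensionField gM gN φ) x =
      ∑ i, ∑ j, (frameSign p i * frameSign p j) •
        fourthFundamentalForm gM gN φ (e i) (e i) (e j) (e j) x := by
  rw [roughLaplacian, connectionAdjoint, neg_neg, oneFormDivergence_eq hφ he hm (fun k ↦
    isSmoothAlong_pullbackConnection gN hφ he.isOpen (he.isSmoothAlong_tensionField hφ hm)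
      (he.contMDiffOn k)) hx]
  refine Finset.sum_congr rfl fun i _ ↦ ?_
  rw [← he.sum_fourthFundamentalForm hφ hm (he.contMDiffOn i) (he.contMDiffOn i) hx,
    Finset.smul_sum]
  exact Finset.sum_congr rfl fun j _ ↦ smul_smul ..

theorem trace_curvatureTensor {x : M} (hx : x ∈ U) :
    gM.trace x (fun u v ↦ curvatureTensor gN.leviCivita (φ x) (mfderiv I I' φ x u)
        (tensionField gM gN φ x) (mfderiv I I' φ x v)) =
      - ∑ i, ∑ j, (frameSign p i * frameSign p j) •
        curvatureTensor gN.leviCivita (φ x) (secondFundamentalForm gM gN φ (e i) (e i) x)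
          (mfderiv I I' φ x (e j x)) (mfderiv I I' φ x (e j x)) := by
  rw [he.trace_eq hx (b := fun j k ↦ gN.curvatureBilin (φ x) (tensionField gM gN φ x)
    (mfderiv I I' φ x (e j x)) (mfderiv I I' φ x (e k x)))]
  · rw [Finset.sum_comm, ← Finset.sum_neg_distrib]
    refine Finset.sum_congr rfl fun j _ ↦ ?_
    rw [gN.curvatureBilin_apply, gN.curvatureTensor_swap, ← gN.curvatureBilin_apply,
      he.tensionField_eq hφ hm hx]
    simp only [map_sum, map_smul, LinearMap.sum_apply, LinearMap.smul_apply,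
      gN.curvatureBilin_apply, smul_neg, Finset.smul_sum, smul_smul, mul_comm]
  · intro u v
    conv_lhs => rw [← he.sum_smul hm hx u, ← he.sum_smul hm hx v]
    simp only [← gN.curvatureBilin_apply, map_sum, map_smul, LinearMap.sum_apply,
      LinearMap.smul_apply, frameBilin_apply, smul_smul, Finset.smul_sum]
    rw [Finset.sum_comm]
    simp only [mul_comm]

end IsPseudoOrthonormalFrame

end Tension

end

theorem proposition3p6 {m n p q : ℕ}
    {M : Type*} [TopologicalSpace M] [ChartedSpace (EuclideanSpace ℝ (Fin m)) M]
    [IsManifold (𝓡 m) ∞ M]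
    {N : Type*} [TopologicalSpace N] [ChartedSpace (EuclideanSpace ℝ (Fin n)) N]
    [IsManifold (𝓡 n) ∞ N]
    (gM : PseudoRiemannianMetric (𝓡 m) M p) (gN : PseudoRiemannianMetric (𝓡 n) N q)
    (φ : M → N) (hφ : ContMDiff (𝓡 m) (𝓡 n) ∞ φ)
    (U : Set M) (e : Fin m → Π x : M, TangentSpace (𝓡 m) x)
    (he : IsPseudoOrthonormalFrame gM e U) (x : M) (hx : x ∈ U) :
    roughLaplacian gM gN φ (tensionField gM gN φ) x =
        ∑ i, ∑ j, (frameSign p i * frameSign p j) •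
          fourthFundamentalForm gM gN φ (e i) (e i) (e j) (e j) x ∧
      bitensionField gM gN φ x =
        ∑ i, ∑ j, (frameSign p i * frameSign p j) •
          (fourthFundamentalForm gM gN φ (e i) (e i) (e j) (e j) x +
            curvatureTensor gN.leviCivita (φ x) (secondFundamentalForm gM gN φ (e i) (e i) x)
              (mfderiv (𝓡 m) (𝓡 n) φ x (e j x)) (mfderiv (𝓡 m) (𝓡 n) φ x (e j x))) := by
  have hm : Module.finrank ℝ (EuclideanSpace ℝ (Fin m)) = m := by simp
  refine ⟨he.roughLaplacian_tensionField hφ hm hx, ?_⟩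
  rw [bitensionField, he.roughLaplacian_tensionField hφ hm hx, he.trace_curvatureTensor hφ hm hx,
    sub_neg_eq_add]
  simp only [smul_add, Finset.sum_add_distrib]
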